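/- Let $n>2$ be an integer and let $\nu$ be a real number with $\nu>\frac{n-2}{2}$. For $z\in\mathbb{C}^n$ write $zz^t=z_1^2+\cdots+z_n^2$, and let $$\mathscr{D}=\{z\in\mathbb{C}^n : 1-2\langle z,z\rangle+|zz^t|^2>0,\ |z|<1\}$$ be the Lie ball, where $\langle z,w\rangle=\sum_i z_i\overline{w_i}$ and $|z|^2=\langle z,z\rangle$. Put $h(z,w)=1-2\langle z,w\rangle+(zz^t)\overline{(ww^t)}$ and $K_\nu(z,w)=h(z,w)^{-\nu}$ for $z,w\in\mathscr{D}$ (principal power; $h(z,w)\notin(-\infty,0]$ there). Then $K_\nu$ is a positive semidefinite kernel on $\mathscr{D}$. Let $\mathscr{H}_\nu$ be the Hilbert space of functions on $\mathscr{D}$ with reproducing kernel $K_\nu$, and $\|\cdot\|_\nu$ its norm. For every integer $k\ge 0$ the function $z\mapsto (zz^t)^k$ belongs to $\mathscr{H}_\nu$, and $$\|(zz^t)^k\|_\nu^2=\frac{k!\,\left(\frac n2\right)_k}{(\nu)_k\left(\nu-\frac{n-2}{2}\right)_k},$$ where $(a)_k=a(a+1)\cdots(a+k-1)$ and $(a)_0=1$.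 -/

import Mathlib

/-- The quadratic form `q(z) = z zᵗ = z₁² + ⋯ + zₙ²` on `ℂⁿ` (bilinear, without conjugation). -/
def quadForm {n : ℕ} (z : EuclideanSpace ℂ (Fin n)) : ℂ :=
  ∑ i, z i ^ 2

/-- The Lie ball `{z ∈ ℂⁿ | 1 - 2⟨z, z⟩ + |z zᵗ|² > 0, |z| < 1}`, with the Euclidean norm `|z|`. -/
def lieBall (n : ℕ) : Set (EuclideanSpace ℂ (Fin n)) :=
  {z | 0 < 1 - 2 * ‖z‖ ^ 2 + ‖quadForm z‖ ^ 2 ∧ ‖z‖ < 1}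

/-- `h(z, w) = 1 - 2⟨z, w⟩ + (z zᵗ) conj(w wᵗ)`, where `⟨z, w⟩ = ∑ zᵢ conj(wᵢ)` is linear in `z`. -/
noncomputable def lieH {n : ℕ} (z w : EuclideanSpace ℂ (Fin n)) : ℂ :=
  1 - 2 * ∑ i, z i * (starRingEnd ℂ) (w i) + quadForm z * (starRingEnd ℂ) (quadForm w)

/-- The kernel `K_ν(z, w) = h(z, w)^(-ν)` on the Lie ball. The values of a kernel in Mathlib's
sense are operators on `ℂ`; here they are the multiplications by the numbers `h(z, w)^(-ν)`.
The power is the principal one: for `z, w` in the Lie ball, `h(z, w)` never lies on `(-∞, 0]`, so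
this is the branch that is holomorphic in `z`, antiholomorphic in `w`, and equal to `1` at
`z = w = 0`. -/
noncomputable def lieKernel (n : ℕ) (ν : ℝ) :
    Matrix (lieBall n) (lieBall n) (ℂ →L[ℂ] ℂ) :=
  Matrix.of fun z w =>
    (lieH (z : EuclideanSpace ℂ (Fin n)) (w : EuclideanSpace ℂ (Fin n)) ^ (-(ν : ℂ))) •
      ContinuousLinearMap.id ℂ ℂ

/-- The Hilbert space `H_ν` of functions on the Lie ball with reproducing kernel `K_ν`: the
completion of the span of the functions `K_ν(·, w)` for the inner product with
`⟨K_ν(·, w), K_ν(·, w')⟩ = K_ν(w', w)` (for the inner product linear in the first variable).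
It exists as soon as `K_ν` is positive semidefinite. -/
abbrev LieHilbert (n : ℕ) (ν : ℝ) [Fact (lieKernel n ν).PosSemidef] : Type :=
  RKHS.OfKernel (lieKernel n ν)

/-- The Pochhammer symbol `(a)ₖ = a (a + 1) ⋯ (a + k - 1)`. -/
noncomputable def poch (a : ℝ) (k : ℕ) : ℝ :=
  ∏ j ∈ Finset.range k, (a + j)

/-! Put lam = (n - 2)/2 and q(z) = zzᵗ. With s = ⟨z, w⟩ and p = q(z) conj(q(w)), the kernel K_ν is
the sum over N of `gegen ν s p N`, homogeneous of degree N in z. By `gegen_connection` each of these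
is a combination of the terms p^j `gegen lam s p (N - 2 * j)` with coefficients that are positive
for ν > lam. The index lam is the one for which `gegen lam` is harmonic in dimension n
(`laplacian_zonal`); it is then a positive multiple of a Gram kernel for the Fischer pairing
(`exists_fischer_zonal`). So every homogeneous part of K_ν is positive semidefinite.

Positivity also gives convergence. On the diagonal the series converges by inspection, and
Cauchy–Schwarz extends this to all pairs in the ball. For a natural exponent, convergence forces h ≠
0 (`lieH_ne_zero`); scaling z then puts both reciprocal roots of 1 - 2sX + pX² in the unit disc,
which sums the series to the principal power (`hasSum_lieTerm`).

The norm is read off in degree 2k. Fischer pairing with q^k kills every summand of the connection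
formula except j = k, so it turns the kernel into a multiple of a conj(q)^k, where a = `connCoeff ν
lam k 0`. Hence q^k has squared norm 1/a in that degree (`exists_feature_quadForm_pow`). The
different degrees are orthogonal summands of H_ν because the ball is stable under z ↦ tz for |t| ≤ 1
(`exists_lieKernel_features`). -/

/-! ### Gegenbauer polynomials and Pochhammer symbols. -/

/-- Homogenized Gegenbauer polynomials: the coefficients of `X ^ N` in `(1 - 2 s X + p X²) ^ (-ν)`,
given by their three-term recurrence. -/
noncomputable def gegen {R : Type*} [CommRing R] [Algebra ℝ R] (ν : ℝ) (s p : R) : ℕ → R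
  | 0 => 1
  | 1 => (2 * ν) • s
  | N + 2 => ((N : ℝ) + 2)⁻¹ • ((2 * (N + 1 + ν)) • (s * gegen ν s p (N + 1)) -
      (N + 2 * ν) • (p * gegen ν s p N))

lemma gegen_zero {R : Type*} [CommRing R] [Algebra ℝ R] (ν : ℝ) (s p : R) :
    gegen ν s p 0 = 1 := by rw [gegen]

lemma gegen_one {R : Type*} [CommRing R] [Algebra ℝ R] (ν : ℝ) (s p : R) :
    gegen ν s p 1 = (2 * ν) • s := by rw [gegen]

lemma gegen_add_two {R : Type*} [CommRing R] [Algebra ℝ R] (ν : ℝ) (s p : R) (N : ℕ) :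
    gegen ν s p (N + 2) = ((N : ℝ) + 2)⁻¹ • ((2 * (N + 1 + ν)) • (s * gegen ν s p (N + 1)) -
      (N + 2 * ν) • (p * gegen ν s p N)) := by rw [gegen]

lemma smul_gegen_add_two {R : Type*} [CommRing R] [Algebra ℝ R] (ν : ℝ) (s p : R) (N : ℕ) :
    ((N : ℝ) + 2) • gegen ν s p (N + 2) = (2 * (N + 1 + ν)) • (s * gegen ν s p (N + 1)) -
      (N + 2 * ν) • (p * gegen ν s p N) := by
  rw [gegen_add_two, smul_inv_smul₀ (by positivity)]

lemma gegen_complex_add_two (ν : ℝ) (s p : ℂ) (N : ℕ) :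
    ((N : ℂ) + 2) * gegen ν s p (N + 2) = 2 * (N + 1 + ν) * s * gegen ν s p (N + 1) -
      (N + 2 * ν) * p * gegen ν s p N := by
  have := smul_gegen_add_two ν s p N
  simp only [Complex.real_smul] at this
  push_cast at this
  rw [this]; ring

lemma map_gegen {R S : Type*} [CommRing R] [Algebra ℝ R] [CommRing S] [Algebra ℝ S]
    (f : R →+* S) (hf : ∀ (c : ℝ) (x : R), f (c • x) = c • f x) (ν : ℝ) (s p : R) (N : ℕ) :
    f (gegen ν s p N) = gegen ν (f s) (f p) N := by
  induction N using Nat.twoStepInduction with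
  | zero => simp [gegen_zero]
  | one => simp [gegen_one, hf]
  | more N h1 h2 => simp [gegen_add_two, hf, h1, h2]

lemma gegen_smul {R : Type*} [CommRing R] [Algebra ℝ R] (ν : ℝ) (t s p : R) (N : ℕ) :
    gegen ν (t * s) (t ^ 2 * p) N = t ^ N * gegen ν s p N := by
  induction N using Nat.twoStepInduction with
  | zero => simp [gegen_zero]
  | one => simp [gegen_one]
  | more N h1 h2 =>
    simp only [gegen_add_two, h1, h2, mul_smul_comm, mul_sub]
    congr 3 <;> ring

lemma poch_zero (a : ℝ) : poch a 0 = 1 := by simp [poch]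

lemma poch_succ (a : ℝ) (k : ℕ) : poch a (k + 1) = poch a k * (a + k) := by
  simp [poch, Finset.prod_range_succ]

lemma poch_succ_left (a : ℝ) (k : ℕ) : poch a (k + 1) = a * poch (a + 1) k := by
  simp only [poch, Finset.prod_range_succ']
  rw [mul_comm]
  congr 1
  · simp
  · refine Finset.prod_congr rfl fun i _ => ?_
    push_cast; ring

lemma poch_pos {a : ℝ} (ha : 0 < a) (k : ℕ) : 0 < poch a k :=
  Finset.prod_pos fun _ _ => by positivity

/-! ### Binomial series and the Gegenbauer generating function. -/

/-- The coefficients of the power series of `(1 - X) ^ (-ν)`. -/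
noncomputable def negBinom (ν : ℝ) (i : ℕ) : ℝ := poch ν i / (i.factorial : ℝ)

lemma negBinom_zero (ν : ℝ) : negBinom ν 0 = 1 := by simp [negBinom, poch_zero]

lemma negBinom_succ (ν : ℝ) (i : ℕ) :
    ((i : ℝ) + 1) * negBinom ν (i + 1) = (ν + i) * negBinom ν i := by
  have := Nat.factorial_ne_zero i
  simp only [negBinom, poch_succ, Nat.factorial_succ]
  push_cast
  field_simp

lemma negBinom_shift (ν : ℝ) (i : ℕ) :
    negBinom (ν + 1) (i + 1) - negBinom (ν + 1) i = negBinom ν (i + 1) := by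
  have := Nat.factorial_ne_zero i
  simp only [negBinom, poch_succ_left ν, poch_succ (ν + 1), Nat.factorial_succ]
  push_cast
  field_simp
  ring

lemma negBinom_eq_choose (ν : ℝ) (i : ℕ) :
    (negBinom ν i : ℂ) = Ring.choose ((ν : ℂ) + i - 1) i := by
  rw [← Ring.multichoose_eq]
  have h := Ring.factorial_nsmul_multichoose_eq_ascPochhammer (ν : ℂ) i
  rw [Polynomial.ascPochhammer_smeval_eq_eval] at h
  have h2 : (ascPochhammer ℂ i).eval (ν : ℂ) = (poch ν i : ℂ) := by
    induction i with
    | zero => simp [poch_zero]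
    | succ i ih =>
      rw [ascPochhammer_succ_right, Polynomial.eval_mul, ih, poch_succ]
      · simp
      · exact Ring.factorial_nsmul_multichoose_eq_ascPochhammer (ν : ℂ) i |>.trans
          (Polynomial.ascPochhammer_smeval_eq_eval _ _)
  have h3 : (i.factorial : ℂ) ≠ 0 := by exact_mod_cast Nat.factorial_ne_zero i
  rw [h2, nsmul_eq_mul] at h
  simp only [negBinom]
  push_cast
  field_simp
  rw [← h, mul_comm]

lemma hasSum_negBinom (ν : ℝ) {α : ℂ} (hα : ‖α‖ < 1) :
    HasSum (fun i => (negBinom ν i : ℂ) * α ^ i) ((1 - α) ^ (-(ν : ℂ))) := by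
  have h := (Complex.one_div_one_sub_cpow_hasFPowerSeriesOnBall_zero (ν : ℂ)).hasSum
    (y := α) (by simpa [Metric.mem_eball, edist_zero_right, enorm_eq_nnnorm, ← NNReal.coe_lt_one] using hα)
  simp only [FormalMultilinearSeries.ofScalars_apply_eq, zero_add, one_div, smul_eq_mul,
    ← negBinom_eq_choose] at h
  rwa [Complex.cpow_neg]

lemma summable_norm_negBinom (ν : ℝ) {α : ℂ} (hα : ‖α‖ < 1) :
    Summable fun i => ‖(negBinom ν i : ℂ) * α ^ i‖ :=
  (hasSum_negBinom ν hα).summable.norm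

open PowerSeries in
/-- The power series of `(1 - α X) ^ (-ν)`. -/
noncomputable def negBinomSeries (ν : ℝ) (α : ℂ) : PowerSeries ℂ :=
  PowerSeries.mk fun i => (negBinom ν i : ℂ) * α ^ i

open PowerSeries in
lemma derivative_negBinomSeries (ν : ℝ) (α : ℂ) :
    (1 - C α * X) * derivative ℂ (negBinomSeries ν α) = C (ν * α) * negBinomSeries ν α := by
  have key (i : ℕ) : ((i : ℂ) + 1) * negBinom ν (i + 1) = (ν + i) * negBinom ν i := by
    exact_mod_cast negBinom_succ ν i
  ext i
  rw [sub_mul, one_mul, map_sub, mul_assoc, coeff_C_mul, coeff_C_mul]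
  rcases i with _ | i
  · have := key 0
    simp only [Nat.cast_zero, zero_add, add_zero, one_mul] at this
    simp [negBinomSeries, coeff_derivative, this, negBinom_zero]
  · rw [coeff_succ_X_mul]
    simp only [negBinomSeries, coeff_derivative, coeff_mk]
    have := key (i + 1)
    push_cast at this ⊢
    linear_combination α ^ (i + 2) * this

open PowerSeries in
lemma negBinomSeries_shift (ν : ℝ) (α : ℂ) :
    (1 - C α * X) * negBinomSeries (ν + 1) α = negBinomSeries ν α := by
  ext i
  rw [sub_mul, one_mul, map_sub, mul_assoc, coeff_C_mul]
  rcases i with _ | i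
  · simp [negBinomSeries, negBinom_zero]
  · rw [coeff_succ_X_mul]
    simp only [negBinomSeries, coeff_mk]
    have : (negBinom (ν + 1) (i + 1) : ℂ) - negBinom (ν + 1) i = negBinom ν (i + 1) := by
      exact_mod_cast negBinom_shift ν i
    rw [← this]; ring

-- The product F of the two binomial series satisfies (1 - 2sX + pX²) F' = 2ν (s - pX) F; comparing
-- coefficients gives the three-term recurrence of `gegen`.
open PowerSeries in
lemma coeff_negBinomSeries_mul (ν : ℝ) {s p α β : ℂ} (hs : α + β = 2 * s) (hp : α * β = p)
    (N : ℕ) : coeff N (negBinomSeries ν α * negBinomSeries ν β) = gegen ν s p N := by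
  set A := negBinomSeries ν α
  set B := negBinomSeries ν β
  have hA := derivative_negBinomSeries ν α
  have hB := derivative_negBinomSeries ν β
  have hD : derivative ℂ (A * B) = A * derivative ℂ B + B * derivative ℂ A := by
    simp [Derivation.leibniz]
  have h : derivative ℂ (A * B) - C (2 * s) * (X * derivative ℂ (A * B))
      + C p * (X * (X * derivative ℂ (A * B))) =
      C (2 * ν * s) * (A * B) - C (2 * ν * p) * (X * (A * B)) := by
    rw [hD]
    have e1 : (C (2 * s) : PowerSeries ℂ) = C α + C β := by rw [← map_add, hs]
    have e2 : (C p : PowerSeries ℂ) = C α * C β := by rw [← map_mul, hp]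
    have e3 : (C (2 * ν * s) : PowerSeries ℂ) = C (ν * α) + C (ν * β) := by
      rw [← map_add]; congr 1; linear_combination -ν * hs
    have e4 : (C (2 * ν * p) : PowerSeries ℂ) = C (ν * α) * C β + C (ν * β) * C α := by
      rw [← map_mul, ← map_mul, ← map_add]; congr 1; rw [← hp]; ring
    rw [e1, e2, e3, e4]
    linear_combination (1 - C β * X) * B * hA + (1 - C α * X) * A * hB
  have hc (N : ℕ) := congrArg (coeff N) h
  simp only [map_add, map_sub, coeff_C_mul, coeff_derivative] at hc
  induction N using Nat.twoStepInduction with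
  | zero => simp [gegen_zero, A, B, negBinomSeries, negBinom_zero]
  | one =>
    have h0 := hc 0
    simp only [coeff_zero_X_mul] at h0
    have : coeff 0 (A * B) = 1 := by simp [A, B, negBinomSeries, negBinom_zero]
    rw [this] at h0
    simp only [gegen_one, Complex.real_smul]
    push_cast at h0 ⊢
    linear_combination h0
  | more N h1 h2 =>
    have h0 := hc (N + 1)
    rw [coeff_succ_X_mul, coeff_succ_X_mul, coeff_succ_X_mul] at h0
    have e : coeff N (X * derivative ℂ (A * B)) = N * coeff N (A * B) := by
      rcases N with _ | N
      · simp
      · rw [coeff_succ_X_mul, coeff_derivative]; push_cast; ring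
    rw [e, coeff_derivative, h1, h2] at h0
    have hN : (N : ℂ) + 2 ≠ 0 := by exact_mod_cast (by omega : N + 2 ≠ 0)
    apply mul_left_cancel₀ hN
    rw [gegen_complex_add_two]
    push_cast at h0
    linear_combination h0

lemma exists_roots (s p : ℂ) : ∃ α β : ℂ, α + β = 2 * s ∧ α * β = p := by
  obtain ⟨d, hd⟩ := IsAlgClosed.exists_pow_nat_eq (s ^ 2 - p) (n := 2) (by norm_num)
  exact ⟨s + d, s - d, by ring, by linear_combination -hd⟩

/-- Both 1 - α and 1 - β lie in the right half-plane, so their arguments add without leaving (-π, π)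
and the principal power is multiplicative on them. The rest is a Cauchy product of absolutely
convergent series. -/
lemma hasSum_gegen_of_roots (ν : ℝ) {s p α β : ℂ} (hs : α + β = 2 * s) (hp : α * β = p)
    (hα : ‖α‖ < 1) (hβ : ‖β‖ < 1) :
    HasSum (gegen ν s p) ((1 - 2 * s + p) ^ (-(ν : ℂ))) := by
  have hre (x : ℂ) (hx : ‖x‖ < 1) : 0 < (1 - x).re := by
    have := Complex.re_le_norm x
    simp only [Complex.sub_re, Complex.one_re]; linarith
  have hprod : ((1 - 2 * s + p) ^ (-(ν : ℂ))) =
      (1 - α) ^ (-(ν : ℂ)) * (1 - β) ^ (-(ν : ℂ)) := by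
    have : 1 - 2 * s + p = (1 - α) * (1 - β) := by rw [← hs, ← hp]; ring
    have h1 := Complex.abs_arg_lt_pi_div_two_iff.2 (Or.inl (hre α hα))
    have h2 := Complex.abs_arg_lt_pi_div_two_iff.2 (Or.inl (hre β hβ))
    rw [abs_lt] at h1 h2
    have hne (x : ℂ) (hx : ‖x‖ < 1) : 1 - x ≠ 0 := fun h => by
      have := hre x hx; rw [h] at this; simp at this
    rw [this, Complex.cpow_def_of_ne_zero (mul_ne_zero (hne α hα) (hne β hβ)),
      Complex.cpow_def_of_ne_zero (hne α hα), Complex.cpow_def_of_ne_zero (hne β hβ),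
      Complex.log_mul (hne α hα) (hne β hβ) ⟨by linarith, by linarith⟩, ← Complex.exp_add, add_mul]
  have hsum := summable_norm_sum_mul_antidiagonal_of_summable_norm
    (summable_norm_negBinom ν hα) (summable_norm_negBinom ν hβ)
  have htsum := tsum_mul_tsum_eq_tsum_sum_antidiagonal_of_summable_norm
    (summable_norm_negBinom ν hα) (summable_norm_negBinom ν hβ)
  rw [(hasSum_negBinom ν hα).tsum_eq, (hasSum_negBinom ν hβ).tsum_eq] at htsum
  rw [hprod, htsum]
  have : gegen ν s p = fun N => ∑ kl ∈ Finset.HasAntidiagonal.antidiagonal N,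
      (negBinom ν kl.1 : ℂ) * α ^ kl.1 * ((negBinom ν kl.2 : ℂ) * β ^ kl.2) := by
    ext N
    rw [← coeff_negBinomSeries_mul ν hs hp, PowerSeries.coeff_mul]
    simp [negBinomSeries]
  rw [this]
  exact hsum.of_norm.hasSum

lemma gegen_shift_zero_one (ν : ℝ) (s p : ℂ) :
    gegen ν s p 1 = gegen (ν + 1) s p 1 - 2 * s * gegen (ν + 1) s p 0 := by
  simp only [gegen_one, gegen_zero, Complex.real_smul]
  push_cast; ring

-- The generating function for ν is that for ν + 1 multiplied by 1 - 2sX + pX².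
open PowerSeries in
lemma gegen_shift (ν : ℝ) (s p : ℂ) (N : ℕ) :
    gegen ν s p (N + 2) = gegen (ν + 1) s p (N + 2) - 2 * s * gegen (ν + 1) s p (N + 1)
      + p * gegen (ν + 1) s p N := by
  obtain ⟨α, β, hs, hp⟩ := exists_roots s p
  simp only [← coeff_negBinomSeries_mul _ hs hp]
  set F := negBinomSeries (ν + 1) α * negBinomSeries (ν + 1) β with hF
  have : negBinomSeries ν α * negBinomSeries ν β =
      F - C (2 * s) * (X * F) + C p * (X * (X * F)) := by
    rw [← hs, ← hp, ← negBinomSeries_shift ν α, ← negBinomSeries_shift ν β, hF, map_add, map_mul]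
    ring
  rw [this, map_add, map_sub, coeff_C_mul, coeff_C_mul, coeff_succ_X_mul, coeff_succ_X_mul,
    coeff_succ_X_mul]

/-- If the series of `(1 - 2s + p) ^ (-m)`, `m` a natural number, converges, then
`1 - 2s + p ≠ 0`. -/
lemma summable_gegen_nat (m : ℕ) (s p : ℂ) (h : Summable (gegen m s p)) :
    (1 - 2 * s + p) ^ m * ∑' N, gegen m s p N = 1 := by
  induction m with
  | zero =>
    have h0 : ∀ N, gegen 0 s p (N + 1) = 0 := by
      intro N
      induction N using Nat.twoStepInduction with
      | zero => simp [gegen_one]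
      | one => simp [gegen_add_two, gegen_one]
      | more N h1 h2 => rw [gegen_add_two, h2, h1]; simp
    rw [tsum_eq_single 0]
    · simp [gegen_zero]
    · intro N hN
      obtain ⟨N, rfl⟩ := Nat.exists_eq_succ_of_ne_zero hN
      simpa using h0 N
  | succ m ih =>
    push_cast at h
    have s1 := (summable_nat_add_iff 1).2 h
    have s2 := (summable_nat_add_iff 2).2 h
    have hs : HasSum (fun N => gegen m s p (N + 2))
        ((∑' N, gegen (m + 1 : ℝ) s p (N + 2)) - 2 * s * (∑' N, gegen (m + 1 : ℝ) s p (N + 1))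
          + p * ∑' N, gegen (m + 1 : ℝ) s p N) := by
      simp only [gegen_shift (m : ℝ)]
      exact (s2.hasSum.sub (s1.hasSum.mul_left _)).add (h.hasSum.mul_left _)
    have hm : Summable (gegen m s p) := (summable_nat_add_iff 2).1 hs.summable
    -- Lowering the exponent by one multiplies the sum by 1 - 2s + p. The shift formula starts at
    -- index 2, so the first two terms are treated separately.
    have key : ∑' N, gegen m s p N = (1 - 2 * s + p) * ∑' N, gegen (m + 1 : ℝ) s p N := by
      have e1 := hm.sum_add_tsum_nat_add 2
      have e2 := h.sum_add_tsum_nat_add 2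
      have e3 := h.sum_add_tsum_nat_add 1
      rw [hs.tsum_eq] at e1
      simp only [Finset.sum_range_succ, Finset.sum_range_zero, gegen_zero, zero_add] at e1 e2 e3
      rw [gegen_shift_zero_one, gegen_zero] at e1
      linear_combination -e1 + e2 - 2 * s * e3
    have := ih hm
    rw [key] at this
    push_cast
    rw [pow_succ, mul_assoc, this]

/-! ### The connection formula between two Gegenbauer indices. -/

/-- The coefficient of `p ^ j * gegen lam s p l` in the expansion of `gegen ν s p (2 * j + l)`. -/
noncomputable def connCoeff (ν lam : ℝ) (j l : ℕ) : ℝ :=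
  (l + lam) * poch ν (l + j) * poch (ν - lam) j / (j.factorial * poch lam (l + j + 1))

lemma connCoeff_pos {ν lam : ℝ} (hlam : 0 < lam) (hν : lam < ν) (j l : ℕ) :
    0 < connCoeff ν lam j l := by
  have h1 := poch_pos (hlam.trans hν) (l + j)
  have h2 := poch_pos (sub_pos.2 hν) j
  have h3 := poch_pos hlam (l + j + 1)
  unfold connCoeff
  positivity

/-- The numerator lam cancels the first factor of (lam)ₖ₊₁. For lam + 1 = n/2 this is the reciprocal
of the norm sought. -/
lemma connCoeff_zero_right (ν : ℝ) {lam : ℝ} (hlam : 0 < lam) (k : ℕ) :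
    connCoeff ν lam k 0 = poch ν k * poch (ν - lam) k / (k.factorial * poch (lam + 1) k) := by
  have := poch_pos (by linarith : 0 < lam + 1) k
  have := Nat.factorial_ne_zero k
  simp only [connCoeff, zero_add, poch_succ_left lam]
  push_cast
  field_simp
  ring

/-- The `j`-th summand in the expansion of `gegen ν s p N` along `gegen lam s p`. -/
noncomputable def connTerm (ν lam : ℝ) (s p : ℂ) (N j : ℕ) : ℂ :=
  if 2 * j ≤ N then connCoeff ν lam j (N - 2 * j) * p ^ j * gegen lam s p (N - 2 * j) else 0

lemma connTerm_of_lt (ν lam : ℝ) (s p : ℂ) {N j : ℕ} (h : N < 2 * j) :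
    connTerm ν lam s p N j = 0 := by
  simp [connTerm, h]

/-- The part of `s * connTerm N j` that is a multiple of `p ^ j`. -/
noncomputable def connUp (ν lam : ℝ) (s p : ℂ) (N j : ℕ) : ℂ :=
  if 2 * j ≤ N then
    connCoeff ν lam j (N - 2 * j) * ((N - 2 * j : ℕ) + 1) / (2 * ((N - 2 * j : ℕ) + lam)) *
      p ^ j * gegen lam s p (N - 2 * j + 1) else 0

/-- The part of `s * connTerm N j` that is a multiple of `p ^ (j + 1)`. -/
noncomputable def connDown (ν lam : ℝ) (s p : ℂ) (N j : ℕ) : ℂ :=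
  if 2 * j < N then
    connCoeff ν lam j (N - 2 * j) * ((N - 2 * j : ℕ) + 2 * lam - 1) /
      (2 * ((N - 2 * j : ℕ) + lam)) * p ^ (j + 1) * gegen lam s p (N - 2 * j - 1) else 0

/-- This is the recurrence of `gegen lam` solved for s times a Gegenbauer polynomial. In degree 0
there is no lower neighbour, whence the strict inequality in `connDown`. -/
lemma mul_connTerm {ν lam : ℝ} (hlam : 0 < lam) (s p : ℂ) (N j : ℕ) :
    s * connTerm ν lam s p N j = connUp ν lam s p N j + connDown ν lam s p N j := by
  by_cases h : 2 * j ≤ N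
  · obtain ⟨l, rfl⟩ := Nat.exists_eq_add_of_le h
    have hl : ((l : ℂ) + lam) ≠ 0 := by
      exact_mod_cast (by positivity : (0 : ℝ) < l + lam).ne'
    have hlam' : (lam : ℂ) ≠ 0 := by exact_mod_cast hlam.ne'
    rcases l with _ | l
    · simp only [connTerm, connUp, connDown, add_zero, le_refl, lt_irrefl, if_true, if_false,
        Nat.sub_self, gegen_zero, zero_add, gegen_one, Complex.real_smul]
      push_cast
      simp only [zero_add]
      field_simp
    · have := gegen_complex_add_two lam s p l
      have h1 : 2 * j < 2 * j + (l + 1) := by omega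
      simp only [connTerm, connUp, connDown, h, h1, if_true, Nat.add_sub_cancel_left,
        Nat.add_sub_cancel]
      push_cast at hl ⊢
      field_simp
      linear_combination (-(connCoeff ν lam j (l + 1) : ℂ) * p ^ j) * this
  · simp [connTerm, connUp, connDown, h, show ¬ 2 * j < N by omega]

lemma connTerm_recurrence_zero {ν lam : ℝ} (hlam : 0 < lam) (s p : ℂ) (N : ℕ) :
    ((N : ℂ) + 2) * connTerm ν lam s p (N + 2) 0 =
      2 * (N + 1 + ν) * connUp ν lam s p (N + 1) 0 := by
  have hl : ((N : ℂ) + 1 + lam) ≠ 0 := by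
    exact_mod_cast (by positivity : (0 : ℝ) < N + 1 + lam).ne'
  have hl2 : (lam + ((N : ℂ) + 2)) ≠ 0 := by
    exact_mod_cast (by positivity : (0 : ℝ) < lam + (N + 2)).ne'
  have hp : (poch lam (N + 1 + 1) : ℂ) ≠ 0 := by exact_mod_cast (poch_pos hlam (N + 1 + 1)).ne'
  simp only [connTerm, connUp, connCoeff, mul_zero, Nat.zero_le, if_true, Nat.sub_zero, add_zero,
    poch_succ lam (N + 2), poch_succ ν (N + 1), Nat.factorial_zero]
  push_cast
  field_simp
  ring

/-- All terms are multiples of p^(j+1) `gegen lam s p (N - 2 * j)`, so this is an identity between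
rational coefficients. -/
lemma connTerm_recurrence {ν lam : ℝ} (hlam : 0 < lam) (s p : ℂ) (N j : ℕ) :
    ((N : ℂ) + 2) * connTerm ν lam s p (N + 2) (j + 1) =
      2 * (N + 1 + ν) * (connUp ν lam s p (N + 1) (j + 1) + connDown ν lam s p (N + 1) j) -
      (N + 2 * ν) * (p * connTerm ν lam s p N j) := by
  by_cases h : 2 * j ≤ N
  swap
  · simp [connTerm, connUp, connDown, show ¬ 2 * (j + 1) ≤ N + 2 by omega,
      show ¬ 2 * (j + 1) ≤ N + 1 by omega, show ¬ 2 * j < N + 1 by omega, h]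
  obtain ⟨l, rfl⟩ := Nat.exists_eq_add_of_le h
  have pos (x : ℝ) (hx : 0 < x) : (x : ℂ) ≠ 0 := by exact_mod_cast hx.ne'
  have hf := pos _ (by positivity : (0 : ℝ) < j.factorial)
  have hj := pos _ (by positivity : (0 : ℝ) < j + 1)
  have h0 := pos _ hlam
  have h1 := pos _ (poch_pos hlam (l + j + 1))
  have h2 := pos _ (by positivity : (0 : ℝ) < lam + (l + j + 1))
  have h3 := pos _ (by positivity : (0 : ℝ) < l + lam)
  have h4 := pos _ (by positivity : (0 : ℝ) < l + 1 + lam)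
  push_cast at hj h2 h3 h4 hf
  rcases l with _ | l
  -- For N = 2j the `connUp` term is absent, so the coefficient identity differs from the generic
  -- one.
  · simp only [connTerm, connUp, connDown, connCoeff, add_zero, le_refl, if_true, if_false,
      show 2 * (j + 1) ≤ 2 * j + 2 by omega, show ¬ 2 * (j + 1) ≤ 2 * j + 1 by omega,
      show 2 * j < 2 * j + 1 by omega, show 2 * j + 2 - 2 * (j + 1) = 0 by omega,
      show 2 * j + 1 - 2 * j = 1 by omega, Nat.sub_self, gegen_zero, zero_add,
      show 1 + j = j + 1 by omega, poch_succ _ (j + 1), poch_succ _ j, Nat.factorial_succ]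
    simp only [poch_succ] at h1
    push_cast at h1 h2 ⊢
    simp only [zero_add, mul_ne_zero_iff, mul_one, Nat.cast_zero] at h1 h2 h4 ⊢
    obtain ⟨h1, h5⟩ := h1
    field_simp
    ring
  · simp only [connTerm, connUp, connDown, connCoeff, if_true,
      show 2 * (j + 1) ≤ 2 * j + (l + 1) + 2 by omega,
      show 2 * (j + 1) ≤ 2 * j + (l + 1) + 1 by omega,
      show 2 * j < 2 * j + (l + 1) + 1 by omega, show 2 * j ≤ 2 * j + (l + 1) by omega,
      show 2 * j + (l + 1) + 2 - 2 * (j + 1) = l + 1 by omega,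
      show 2 * j + (l + 1) + 1 - 2 * (j + 1) = l by omega,
      show 2 * j + (l + 1) + 1 - 2 * j = l + 2 by omega,
      show 2 * j + (l + 1) - 2 * j = l + 1 by omega,
      show l + 2 - 1 = l + 1 by omega, Nat.factorial_succ,
      show l + 1 + (j + 1) = l + j + 2 by omega, show l + (j + 1) = l + j + 1 by omega,
      show l + 2 + j = l + j + 2 by omega, show l + 1 + j = l + j + 1 by omega,
      poch_succ _ (l + j + 2), poch_succ _ (l + j + 1), poch_succ (ν - lam) j] at h1 h2 ⊢
    have h6 := pos _ (by positivity : (0 : ℝ) < l + lam)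
    have h7 := pos _ (by positivity : (0 : ℝ) < l + 2 + lam)
    have h8 := pos _ (by positivity : (0 : ℝ) < lam + (l + j + 1))
    have h9 := pos _ (poch_pos hlam (l + j + 1))
    have h10 := pos _ (by positivity : (0 : ℝ) < lam + (l + j + 2))
    push_cast at h1 h2 h3 h4 h6 h7 h8 h10 ⊢
    field_simp
    ring

/-- The connection formula for Gegenbauer polynomials. -/
lemma gegen_connection {ν lam : ℝ} (hlam : 0 < lam) (s p : ℂ) (N M : ℕ) (hM : N < 2 * M) :
    gegen ν s p N = ∑ j ∈ Finset.range M, connTerm ν lam s p N j := by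
  induction N using Nat.twoStepInduction generalizing M with
  | zero =>
    rw [Finset.sum_eq_single_of_mem 0 (by simp; omega)
      (fun j _ hj => connTerm_of_lt _ _ _ _ (by omega))]
    simp [connTerm, connCoeff, gegen_zero, poch, hlam.ne']
  | one =>
    rw [Finset.sum_eq_single_of_mem 0 (by simp; omega)
      (fun j _ hj => connTerm_of_lt _ _ _ _ (by omega))]
    have hl : (lam : ℂ) ≠ 0 := by exact_mod_cast hlam.ne'
    have hl1 : (lam : ℂ) + 1 ≠ 0 := by exact_mod_cast (by positivity : 0 < lam + 1).ne'
    simp only [connTerm, connCoeff, poch, gegen_one, Complex.real_smul, Finset.prod_range_succ,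
      Finset.prod_range_zero, mul_zero, Nat.zero_le, if_true, Nat.sub_zero, Nat.factorial_zero]
    push_cast
    simp only [add_zero, one_mul, mul_one]
    field_simp
    ring
  | more N h1 h2 =>
    have hN : (N : ℂ) + 2 ≠ 0 := by exact_mod_cast (by omega : N + 2 ≠ 0)
    apply mul_left_cancel₀ hN
    obtain ⟨M, rfl⟩ : ∃ M', M = M' + 1 := ⟨M - 1, by omega⟩
    have e : 2 * (N + 1 + ν) * s * gegen ν s p (N + 1) =
        2 * (N + 1 + ν) * (s * gegen ν s p (N + 1)) := by ring
    rw [gegen_complex_add_two, e, h2 (M + 1) (by omega), h1 M (by omega), Finset.mul_sum,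
      Finset.sum_congr rfl fun j _ => mul_connTerm hlam s p (N + 1) j, Finset.sum_add_distrib,
      Finset.sum_range_succ' (connUp ν lam s p (N + 1)),
      Finset.sum_range_succ (connDown ν lam s p (N + 1)),
      Finset.sum_range_succ', mul_add ((N : ℂ) + 2), Finset.mul_sum _ _ ((N : ℂ) + 2), connTerm_recurrence_zero hlam,
      Finset.sum_congr rfl fun j _ => connTerm_recurrence hlam s p N j,
      Finset.sum_sub_distrib, ← Finset.mul_sum, Finset.sum_add_distrib]
    have : connDown ν lam s p (N + 1) M = 0 := by
      simp [connDown, show ¬ 2 * M < N + 1 by omega]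
    rw [this, ← Finset.mul_sum, ← Finset.mul_sum]
    ring

/-! ### The Fischer pairing, the Laplacian and linear forms. -/

namespace MvPolynomial

variable {n : ℕ}

/-- The product of the factorials of the exponents. -/
def multiFactorial (a : Fin n →₀ ℕ) : ℕ := ∏ i, (a i).factorial

lemma multiFactorial_ne_zero (a : Fin n →₀ ℕ) : (multiFactorial a : ℂ) ≠ 0 := by
  exact_mod_cast (Finset.prod_pos fun i _ => Nat.factorial_pos (a i)).ne'

lemma multiFactorial_add_single (a : Fin n →₀ ℕ) (i : Fin n) :
    multiFactorial (a + Finsupp.single i 1) = (a i + 1) * multiFactorial a := by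
  classical
  unfold multiFactorial
  rw [← Finset.mul_prod_erase _ _ (Finset.mem_univ i),
    ← Finset.mul_prod_erase _ (fun j => (a j).factorial) (Finset.mem_univ i), ← mul_assoc]
  congr 1
  · simp [Nat.factorial_succ]
  · refine Finset.prod_congr rfl fun j hj => ?_
    simp [Finsupp.single_eq_of_ne (Finset.ne_of_mem_erase hj)]

/-- The bilinear Fischer pairing `∑ α! pₐ rₐ` of polynomials. -/
noncomputable def fischer : MvPolynomial (Fin n) ℂ →ₗ[ℂ] MvPolynomial (Fin n) ℂ →ₗ[ℂ] ℂ :=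
  (basisMonomials (Fin n) ℂ).constr ℂ fun a => (multiFactorial a : ℂ) • lcoeff ℂ a

lemma fischer_monomial_one (a : Fin n →₀ ℕ) (r : MvPolynomial (Fin n) ℂ) :
    fischer (monomial a 1) r = multiFactorial a * coeff a r := by
  have := (basisMonomials (Fin n) ℂ).constr_basis ℂ
    (fun a => (multiFactorial a : ℂ) • lcoeff ℂ a) a
  rw [coe_basisMonomials] at this
  simp only [fischer]
  rw [this]
  simp [lcoeff]

lemma fischer_monomial (a : Fin n →₀ ℕ) (c : ℂ) (r : MvPolynomial (Fin n) ℂ) :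
    fischer (monomial a c) r = c * (multiFactorial a * coeff a r) := by
  rw [show monomial a c = c • monomial a (1 : ℂ) by simp [smul_monomial], map_smul,
    LinearMap.smul_apply, fischer_monomial_one, smul_eq_mul]

lemma fischer_eq_sum (p r : MvPolynomial (Fin n) ℂ) :
    fischer p r = ∑ a ∈ p.support, multiFactorial a * (coeff a p * coeff a r) := by
  conv_lhs => rw [p.as_sum]
  rw [map_sum, LinearMap.sum_apply]
  exact Finset.sum_congr rfl fun a _ => by rw [fischer_monomial]; ring

lemma fischer_comm (p r : MvPolynomial (Fin n) ℂ) : fischer p r = fischer r p := by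
  rw [fischer_eq_sum, fischer_eq_sum,
    Finset.sum_subset (s₂ := p.support ∪ r.support) Finset.subset_union_left,
    Finset.sum_subset (s₁ := r.support) (s₂ := p.support ∪ r.support) Finset.subset_union_right]
  · exact Finset.sum_congr rfl fun a _ => by ring
  all_goals
    intro a _ ha
    simp [notMem_support_iff.1 ha]

lemma fischer_X_mul (i : Fin n) (p r : MvPolynomial (Fin n) ℂ) :
    fischer (X i * p) r = fischer p (pderiv i r) := by
  induction p using MvPolynomial.induction_on' with
  | add p q hp hq => simp [mul_add, hp, hq]
  | monomial a c =>
    rw [X, monomial_mul, one_mul, add_comm, fischer_monomial, fischer_monomial, coeff_pderiv,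
      multiFactorial_add_single]
    push_cast; ring

/-- The polynomial `X₁² + ⋯ + Xₙ²`. -/
noncomputable def quad (n : ℕ) : MvPolynomial (Fin n) ℂ := ∑ i, X i ^ 2

/-- The Laplacian on polynomials. -/
noncomputable def laplacian (p : MvPolynomial (Fin n) ℂ) : MvPolynomial (Fin n) ℂ :=
  ∑ i, pderiv i (pderiv i p)

/-- The linear form `v₁ X₁ + ⋯ + vₙ Xₙ`. -/
noncomputable def linForm (v : Fin n → ℂ) : MvPolynomial (Fin n) ℂ := ∑ i, C (v i) * X i

/-- The derivative in the direction `v`. -/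
noncomputable def dirDeriv (v : Fin n → ℂ) :
    Derivation ℂ (MvPolynomial (Fin n) ℂ) (MvPolynomial (Fin n) ℂ) :=
  ∑ i, v i • pderiv i

lemma dirDeriv_apply (v : Fin n → ℂ) (p : MvPolynomial (Fin n) ℂ) :
    dirDeriv v p = ∑ i, C (v i) * pderiv i p := by
  have : dirDeriv v p = ∑ i, (v i • pderiv i) p := by
    rw [dirDeriv, ← Derivation.coeFnAddMonoidHom_apply, map_sum, Finset.sum_apply]
    rfl
  rw [this]
  exact Finset.sum_congr rfl fun i _ => by rw [Derivation.smul_apply, smul_eq_C_mul]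

lemma fischer_quad_mul (p r : MvPolynomial (Fin n) ℂ) :
    fischer (quad n * p) r = fischer p (laplacian r) := by
  simp only [quad, laplacian, Finset.sum_mul, map_sum, LinearMap.sum_apply, pow_two, mul_assoc,
    fischer_X_mul]

lemma pderiv_linForm (v : Fin n → ℂ) (i : Fin n) : pderiv i (linForm v) = C (v i) := by
  classical
  simp only [linForm, map_sum, pderiv_C_mul, pderiv_X]
  rw [Finset.sum_eq_single i]
  · simp
  · intro j _ hj; simp [Pi.single_eq_of_ne hj]
  · simp

lemma pderiv_quad (i : Fin n) : pderiv i (quad n) = 2 * X i := by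
  classical
  simp only [quad, map_sum, pderiv_pow, pderiv_X]
  rw [Finset.sum_eq_single i]
  · simp
  · intro j _ hj; simp [Pi.single_eq_of_ne hj]
  · simp

lemma dirDeriv_linForm (v : Fin n → ℂ) : dirDeriv v (linForm v) = C (∑ i, v i ^ 2) := by
  simp [dirDeriv_apply, pderiv_linForm, pow_two]

lemma dirDeriv_quad (v : Fin n → ℂ) : dirDeriv v (quad n) = 2 * linForm v := by
  simp only [dirDeriv_apply, pderiv_quad, linForm, Finset.mul_sum]
  exact Finset.sum_congr rfl fun i _ => by ring

lemma laplacian_mul (f g : MvPolynomial (Fin n) ℂ) :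
    laplacian (f * g) = f * laplacian g + g * laplacian f
      + 2 * ∑ i, pderiv i f * pderiv i g := by
  simp only [laplacian, pderiv_mul, map_add, Finset.mul_sum, ← Finset.sum_add_distrib]
  exact Finset.sum_congr rfl fun i _ => by ring

lemma laplacian_sub (f g : MvPolynomial (Fin n) ℂ) :
    laplacian (f - g) = laplacian f - laplacian g := by
  simp [laplacian, Finset.sum_sub_distrib]

lemma laplacian_C_mul (c : ℂ) (f : MvPolynomial (Fin n) ℂ) :
    laplacian (C c * f) = C c * laplacian f := by
  simp [laplacian, Finset.mul_sum]

lemma laplacian_linForm_mul (v : Fin n → ℂ) (g : MvPolynomial (Fin n) ℂ) :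
    laplacian (linForm v * g) = linForm v * laplacian g + 2 * dirDeriv v g := by
  have : laplacian (linForm v) = 0 := by simp [laplacian, pderiv_linForm]
  rw [laplacian_mul, this]
  simp [pderiv_linForm, dirDeriv_apply]

lemma laplacian_quad : laplacian (quad n) = 2 * (n : MvPolynomial (Fin n) ℂ) := by
  have (i : Fin n) : pderiv i (2 * X i : MvPolynomial (Fin n) ℂ) = 2 := by
    rw [pderiv_mul, pderiv_X_self, show (2 : MvPolynomial (Fin n) ℂ) = C 2 from (map_ofNat C 2).symm,
      pderiv_C]
    simp
  simp only [laplacian, pderiv_quad, this]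
  simp [mul_comm]

lemma laplacian_quad_mul {g : MvPolynomial (Fin n) ℂ} {d : ℕ} (hg : g.IsHomogeneous d) :
    laplacian (quad n * g) = quad n * laplacian g + (2 * n + 4 * d) * g := by
  have h := hg.sum_X_mul_pderiv
  rw [laplacian_mul, laplacian_quad]
  simp only [pderiv_quad, mul_assoc, ← Finset.mul_sum, h, nsmul_eq_mul]
  ring

lemma isHomogeneous_quad : (quad n).IsHomogeneous 2 :=
  IsHomogeneous.sum _ _ _ fun i _ => isHomogeneous_X_pow i 2

lemma isHomogeneous_quad_pow (k : ℕ) : (quad n ^ k).IsHomogeneous (2 * k) :=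
  isHomogeneous_quad.pow k

lemma isHomogeneous_linForm (v : Fin n → ℂ) : (linForm v).IsHomogeneous 1 :=
  IsHomogeneous.sum _ _ _ fun i _ => isHomogeneous_C_mul_X (v i) i

lemma eval_quad (v : Fin n → ℂ) : eval v (quad n) = ∑ i, v i ^ 2 := by simp [quad]

lemma eval_linForm (u v : Fin n → ℂ) : eval u (linForm v) = ∑ i, v i * u i := by simp [linForm]

lemma laplacian_quad_pow_succ (m : ℕ) :
    laplacian (quad n ^ (m + 1)) = C (2 * (m + 1) * (n + 2 * m) : ℂ) * quad n ^ m := by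
  induction m with
  | zero => simp [laplacian_quad, map_ofNat C 2]
  | succ m ih =>
    rw [pow_succ', laplacian_quad_mul (isHomogeneous_quad_pow (m + 1)), ih]
    simp only [map_mul, map_add, map_ofNat, map_natCast, map_one]
    push_cast
    ring

/-- Powers of linear forms reproduce evaluations for the Fischer pairing. -/
lemma fischer_linForm_pow (v : Fin n → ℂ) (N : ℕ) {p : MvPolynomial (Fin n) ℂ}
    (hp : p.IsHomogeneous N) : fischer p (linForm v ^ N) = N.factorial * eval v p := by
  induction N generalizing p with
  | zero =>
    obtain ⟨c, rfl⟩ : ∃ c, p = C c :=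
      ⟨_, totalDegree_eq_zero_iff_eq_C.1 ((totalDegree_zero_iff_isHomogeneous _).2 hp)⟩
    rw [← monomial_zero', fischer_monomial]
    simp [multiFactorial]
  | succ N ih =>
    -- Euler's identity lowers the degree: it is used once inside the pairing, where each variable
    -- becomes a derivative, and once evaluated at v.
    have e := hp.sum_X_mul_pderiv
    have hN : ((N : ℂ) + 1) ≠ 0 := by exact_mod_cast N.succ_ne_zero
    have h1 := congrArg (fun P => fischer P (linForm v ^ (N + 1))) e
    have h2 := congrArg (eval v) e
    simp only [map_sum, LinearMap.sum_apply, fischer_X_mul, pderiv_pow, pderiv_linForm,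
      nsmul_eq_mul, map_mul, eval_X, map_natCast] at h1 h2
    have h3 (i : Fin n) : fischer (pderiv i p) (((N + 1 : ℕ) : MvPolynomial (Fin n) ℂ) *
        linForm v ^ (N + 1 - 1) * C (v i)) =
        (N + 1) * N.factorial * (v i * eval v (pderiv i p)) := by
      rw [show ((N + 1 : ℕ) : MvPolynomial (Fin n) ℂ) * linForm v ^ (N + 1 - 1) * C (v i) =
        ((N + 1 : ℕ) * v i : ℂ) • linForm v ^ N by
          rw [smul_eq_C_mul, map_mul, map_natCast, Nat.add_sub_cancel]; ring, map_smul, ih]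
      · rw [smul_eq_mul]; push_cast; ring
      · simpa using hp.pderiv (i := i)
    rw [Finset.sum_congr rfl fun i _ => h3 i, ← Finset.mul_sum, h2] at h1
    rw [show ((N + 1 : ℕ) : MvPolynomial (Fin n) ℂ) * p = ((N + 1 : ℕ) : ℂ) • p by
      rw [smul_eq_C_mul, map_natCast], map_smul, LinearMap.smul_apply, smul_eq_mul] at h1
    push_cast at h1 ⊢
    apply mul_left_cancel₀ hN
    rw [← h1, Nat.factorial_succ]
    push_cast
    ring

/-! ### Zonal harmonics. -/

/-- The zonal harmonic polynomial of degree `l` with pole `v`, for `n = 2 * lam + 2`. -/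
noncomputable def zonal (lam : ℝ) (v : Fin n → ℂ) (l : ℕ) : MvPolynomial (Fin n) ℂ :=
  gegen lam (linForm v) (C (∑ i, v i ^ 2) * quad n) l

lemma real_smul_eq_C_mul (c : ℝ) (p : MvPolynomial (Fin n) ℂ) : c • p = C (c : ℂ) * p := by
  rw [← smul_eq_C_mul]
  exact (algebraMap_smul ℂ c p).symm

lemma zonal_zero (lam : ℝ) (v : Fin n → ℂ) : zonal lam v 0 = 1 := gegen_zero _ _ _

lemma zonal_one (lam : ℝ) (v : Fin n → ℂ) : zonal lam v 1 = C (2 * lam : ℂ) * linForm v := by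
  rw [zonal, gegen_one, real_smul_eq_C_mul]; push_cast; rfl

lemma zonal_add_two (lam : ℝ) (v : Fin n → ℂ) (l : ℕ) :
    C (l + 2 : ℂ) * zonal lam v (l + 2) =
      C (2 * (l + 1 + lam) : ℂ) * (linForm v * zonal lam v (l + 1)) -
      C ((l + 2 * lam) * ∑ i, v i ^ 2 : ℂ) * (quad n * zonal lam v l) := by
  have := smul_gegen_add_two lam (linForm v) (C (∑ i, v i ^ 2) * quad n) l
  simp only [real_smul_eq_C_mul] at this
  push_cast at this
  rw [zonal, this, zonal, zonal, C_mul (a := (l + 2 * lam : ℂ))]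
  ring

lemma C_add_two_ne_zero (l : ℕ) : (C (l + 2 : ℂ) : MvPolynomial (Fin n) ℂ) ≠ 0 := by
  rw [Ne, C_eq_zero]
  exact_mod_cast (by omega : l + 2 ≠ 0)

lemma isHomogeneous_zonal (lam : ℝ) (v : Fin n → ℂ) (l : ℕ) :
    (zonal lam v l).IsHomogeneous l := by
  induction l using Nat.twoStepInduction with
  | zero => rw [zonal_zero]; exact isHomogeneous_one _ _
  | one => rw [zonal_one]; exact (isHomogeneous_linForm v).C_mul _
  | more l h1 h2 =>
    have h := zonal_add_two lam v l
    have hl : (l + 2 : ℂ) ≠ 0 := by exact_mod_cast (by omega : l + 2 ≠ 0)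
    have e : zonal lam v (l + 2) = C (l + 2 : ℂ)⁻¹ * (C (l + 2 : ℂ) * zonal lam v (l + 2)) := by
      rw [← mul_assoc, ← C_mul, inv_mul_cancel₀ hl, C_1, one_mul]
    rw [e, h]
    refine IsHomogeneous.C_mul (IsHomogeneous.sub (IsHomogeneous.C_mul ?_ _)
      (IsHomogeneous.C_mul ?_ _)) _
    · simpa [add_comm, add_left_comm] using (isHomogeneous_linForm v).mul h2
    · simpa [add_comm, add_left_comm] using isHomogeneous_quad.mul h1

lemma dirDeriv_C_mul (v : Fin n → ℂ) (c : ℂ) (p : MvPolynomial (Fin n) ℂ) :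
    dirDeriv v (C c * p) = C c * dirDeriv v p := by
  rw [← smul_eq_C_mul, Derivation.map_smul, smul_eq_C_mul]

lemma dirDeriv_mul (v : Fin n → ℂ) (p r : MvPolynomial (Fin n) ℂ) :
    dirDeriv v (p * r) = p * dirDeriv v r + r * dirDeriv v p := by
  simp [Derivation.leibniz]

/-- This supplies the cross term in the Laplacian of `linForm v * zonal lam v (l + 1)`. -/
lemma dirDeriv_zonal (lam : ℝ) (v : Fin n → ℂ) (l : ℕ) :
    dirDeriv v (zonal lam v (l + 1)) =
      C ((∑ i, v i ^ 2) * (2 * lam + l) : ℂ) * zonal lam v l := by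
  have step (l : ℕ) : C (l + 2 : ℂ) * dirDeriv v (zonal lam v (l + 2)) =
      C (2 * (l + 1 + lam) : ℂ) * (linForm v * dirDeriv v (zonal lam v (l + 1)) +
        zonal lam v (l + 1) * C (∑ i, v i ^ 2)) -
      C ((l + 2 * lam) * ∑ i, v i ^ 2 : ℂ) * (quad n * dirDeriv v (zonal lam v l) +
        zonal lam v l * (2 * linForm v)) := by
    rw [← dirDeriv_C_mul, zonal_add_two, map_sub, dirDeriv_C_mul, dirDeriv_C_mul, dirDeriv_mul,
      dirDeriv_mul, dirDeriv_linForm, dirDeriv_quad]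
  have h1 : dirDeriv v (zonal lam v 1) =
      C ((∑ i, v i ^ 2) * (2 * lam + (0 : ℕ)) : ℂ) * zonal lam v 0 := by
    rw [zonal_one, dirDeriv_C_mul, dirDeriv_linForm, zonal_zero, ← C_mul, mul_one]
    congr 1
    push_cast; ring
  induction l using Nat.twoStepInduction with
  | zero => exact h1
  | one =>
    have h := step 0
    apply mul_left_cancel₀ (C_add_two_ne_zero 0)
    rw [h, zero_add, h1, zonal_one, zonal_zero]
    simp only [map_mul, map_add, map_ofNat, map_natCast, map_one, Derivation.map_one_eq_zero]
    push_cast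
    ring
  | more l ih1 ih2 =>
    have h := step (l + 1)
    apply mul_left_cancel₀ (C_add_two_ne_zero (l + 1))
    rw [h, ih1, ih2]
    have hz := zonal_add_two lam v l
    simp only [map_mul, map_add, map_ofNat, map_natCast, map_one] at hz ⊢
    push_cast
    linear_combination (-C (∑ i, v i ^ 2) * (2 * C (lam : ℂ) + l + 1)) * hz

/-- In the recurrence, the linear form contributes 4(l + 1 + lam) and the quadratic form 2n + 4l,
with the same remaining factor; they cancel exactly for n = 2 lam + 2. -/
lemma laplacian_zonal {lam : ℝ} (hlam : (n : ℝ) = 2 * lam + 2) (v : Fin n → ℂ) (l : ℕ) :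
    laplacian (zonal lam v l) = 0 := by
  have hn : (n : MvPolynomial (Fin n) ℂ) = 2 * C (lam : ℂ) + 2 := by
    have : (n : ℂ) = 2 * lam + 2 := by exact_mod_cast hlam
    rw [← map_natCast C, this]; simp [map_ofNat C 2]
  induction l using Nat.twoStepInduction with
  | zero => simp [zonal_zero, laplacian]
  | one => simp [zonal_one, laplacian, pderiv_linForm]
  | more l ih1 ih2 =>
    apply mul_left_cancel₀ (C_add_two_ne_zero l)
    rw [← laplacian_C_mul, zonal_add_two, laplacian_sub, laplacian_C_mul, laplacian_C_mul,
      laplacian_linForm_mul, laplacian_quad_mul (isHomogeneous_zonal lam v l), ih1, ih2,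
      dirDeriv_zonal, hn]
    simp only [map_mul, map_add, map_ofNat, map_natCast, map_one]
    ring

/-- Modulo the quadratic form, `zonal lam v l` is a positive multiple of `linForm v ^ l`. -/
lemma exists_zonal_eq {lam : ℝ} (hlam : 0 < lam) (l : ℕ) :
    ∃ κ : ℝ, 0 < κ ∧ ∀ v : Fin n → ℂ, ∃ r,
      zonal lam v l = C (κ : ℂ) * linForm v ^ l + quad n * r := by
  induction l using Nat.twoStepInduction with
  | zero => exact ⟨1, one_pos, fun v => ⟨0, by simp [zonal_zero]⟩⟩
  | one => exact ⟨2 * lam, by positivity, fun v => ⟨0, by simp [zonal_one]⟩⟩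
  | more l ih1 ih2 =>
    obtain ⟨κ, hκ, h⟩ := ih2
    refine ⟨(l + 2 : ℝ)⁻¹ * (2 * (l + 1 + lam) * κ), by positivity, fun v => ?_⟩
    obtain ⟨r, hr⟩ := h v
    have hl : (l + 2 : ℂ) ≠ 0 := by exact_mod_cast (by omega : l + 2 ≠ 0)
    have hC : (C (l + 2 : ℂ) : MvPolynomial (Fin n) ℂ) * C (l + 2 : ℂ)⁻¹ = 1 := by
      rw [← C_mul, mul_inv_cancel₀ hl, C_1]
    refine ⟨C (l + 2 : ℂ)⁻¹ * (C (2 * (l + 1 + lam) : ℂ) * (linForm v * r) -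
      C ((l + 2 * lam) * ∑ i, v i ^ 2 : ℂ) * zonal lam v l), ?_⟩
    apply mul_left_cancel₀ (C_add_two_ne_zero l)
    rw [zonal_add_two, hr]
    push_cast
    simp only [C_mul]
    linear_combination (-(C 2 * C (l + 1 + lam : ℂ) * C (κ : ℂ) * linForm v ^ (l + 2)) -
      quad n * (C 2 * C (l + 1 + lam : ℂ) * (linForm v * r) -
      C (l + 2 * lam : ℂ) * C (∑ i, v i ^ 2) * zonal lam v l)) * hC

lemma eval_zonal (lam : ℝ) (u v : Fin n → ℂ) (l : ℕ) :
    eval u (zonal lam v l) = gegen lam (∑ i, v i * u i) ((∑ i, v i ^ 2) * ∑ i, u i ^ 2) l := by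
  rw [zonal, map_gegen]
  · simp [eval_linForm, eval_quad]
  · intro c x; rw [real_smul_eq_C_mul]; simp

lemma map_conj_zonal (lam : ℝ) (v : Fin n → ℂ) (l : ℕ) :
    map (starRingEnd ℂ) (zonal lam v l) = zonal lam (fun i => starRingEnd ℂ (v i)) l := by
  rw [zonal, map_gegen, zonal]
  · simp [linForm, quad]
  · intro c x; simp [real_smul_eq_C_mul]

/-- The values of zonal polynomials are multiples of their Fischer pairings. -/
lemma exists_fischer_zonal {lam : ℝ} (hpos : 0 < lam) (hlam : (n : ℝ) = 2 * lam + 2) (l : ℕ) :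
    ∃ c : ℝ, 0 < c ∧ ∀ u v : Fin n → ℂ,
      eval u (zonal lam v l) = c * fischer (zonal lam v l) (zonal lam u l) := by
  obtain ⟨κ, hκ, h⟩ := exists_zonal_eq (n := n) hpos l
  have hf : (0 : ℝ) < l.factorial := by exact_mod_cast l.factorial_pos
  refine ⟨(κ * l.factorial)⁻¹, by positivity, fun u v => ?_⟩
  obtain ⟨r, hr⟩ := h u
  -- Multiples of the quadratic form are orthogonal to harmonic polynomials, so only the power of
  -- the linear form contributes, and it evaluates at u.
  have e : fischer (zonal lam v l) (quad n * r) = 0 := by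
    rw [fischer_comm, fischer_quad_mul, laplacian_zonal hlam, map_zero]
  have hκ' : (κ : ℂ) ≠ 0 := by exact_mod_cast hκ.ne'
  have hf' : (l.factorial : ℂ) ≠ 0 := by exact_mod_cast hf.ne'
  rw [hr, map_add, e, ← smul_eq_C_mul, map_smul, fischer_linForm_pow u l (isHomogeneous_zonal _ _ _),
    smul_eq_mul]
  push_cast
  field_simp
  simp

lemma fischer_map_conj_nonneg (p : MvPolynomial (Fin n) ℂ) :
    0 ≤ (fischer p (map (starRingEnd ℂ) p)).re := by
  rw [fischer_eq_sum, Complex.re_sum]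
  refine Finset.sum_nonneg fun a _ => ?_
  rw [coeff_map, Complex.mul_conj]
  have : (multiFactorial a : ℂ) * (Complex.normSq (coeff a p) : ℂ) =
      ((multiFactorial a * Complex.normSq (coeff a p) : ℝ) : ℂ) := by push_cast; rfl
  rw [this, Complex.ofReal_re]
  have := Complex.normSq_nonneg (coeff a p)
  positivity

/-! ### Fischer pairing with powers of the quadratic form. -/

/-- Powers of linear forms span the homogeneous polynomials. -/
lemma mem_span_linForm_pow {N : ℕ} {p : MvPolynomial (Fin n) ℂ} (hp : p.IsHomogeneous N) :
    p ∈ Submodule.span ℂ (Set.range fun v : Fin n → ℂ => linForm v ^ N) := by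
  classical
  by_contra hmem
  obtain ⟨f, hfp, hf⟩ := Submodule.exists_le_ker_of_notMem hmem
  set T := Finset.finsuppAntidiag (Finset.univ : Finset (Fin n)) N
  have hT (a : Fin n →₀ ℕ) : a ∈ T ↔ a.degree = N := by
    simp [T, Finset.mem_finsuppAntidiag, Finsupp.degree_eq_sum]
  -- P represents the separating functional f through the Fischer pairing. Since f kills all powers
  -- of linear forms, P vanishes at every point, hence f kills p too.
  set P : MvPolynomial (Fin n) ℂ :=
    ∑ a ∈ T, monomial a (f (monomial a 1) / multiFactorial a)
  have hP : P.IsHomogeneous N :=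
    IsHomogeneous.sum _ _ _ fun a ha => isHomogeneous_monomial _ ((hT a).1 ha)
  have hfP (r : MvPolynomial (Fin n) ℂ) (hr : r.IsHomogeneous N) : fischer P r = f r := by
    have hr' : r = ∑ a ∈ T, coeff a r • monomial a (1 : ℂ) := by
      conv_lhs => rw [r.as_sum]
      have hsub : r.support ⊆ T := fun a ha => (hT a).2 <| by
        by_contra hne
        exact mem_support_iff.1 ha (hr.coeff_eq_zero hne)
      rw [Finset.sum_subset hsub]
      · exact Finset.sum_congr rfl fun a _ => by simp [smul_monomial]
      · intro a _ ha; simp [notMem_support_iff.1 ha]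
    conv_rhs => rw [hr']
    simp only [P, map_sum, LinearMap.sum_apply, fischer_monomial, map_smul, smul_eq_mul]
    refine Finset.sum_congr rfl fun a _ => ?_
    have := multiFactorial_ne_zero a
    field_simp
  have hP0 : P = 0 := by
    refine MvPolynomial.funext fun v => ?_
    have h1 : f (linForm v ^ N) = 0 := hf (Submodule.subset_span ⟨v, rfl⟩)
    have hl : (linForm v ^ N).IsHomogeneous N := by simpa using (isHomogeneous_linForm v).pow N
    rw [← hfP _ hl, fischer_linForm_pow v N hP] at h1
    rw [map_zero]
    exact (mul_eq_zero.1 h1).resolve_left (by exact_mod_cast N.factorial_ne_zero)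
  apply hfp
  rw [← hfP p hp, hP0, map_zero, LinearMap.zero_apply]

/-- Writing the pairing with q^k as a finite combination of point evaluations lets it be applied to
kernels and to feature vectors. -/
lemma exists_fischer_quad_eq_eval (k : ℕ) : ∃ c : (Fin n → ℂ) →₀ ℂ,
    ∀ p : MvPolynomial (Fin n) ℂ, p.IsHomogeneous (2 * k) →
      fischer p (quad n ^ k) = c.sum fun v a => a * eval v p := by
  obtain ⟨c, hc⟩ := Finsupp.mem_span_range_iff_exists_finsupp.1
    (mem_span_linForm_pow (isHomogeneous_quad_pow (n := n) k))
  refine ⟨c.mapRange (fun a => a * (2 * k).factorial) (by simp), fun p hp => ?_⟩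
  rw [Finsupp.sum_mapRange_index (by simp), ← hc, Finsupp.sum, map_sum]
  exact Finset.sum_congr rfl fun v _ => by
    rw [map_smul, fischer_linForm_pow v _ hp, smul_eq_mul]; ring

lemma fischer_quad_mul_quad_pow (p : MvPolynomial (Fin n) ℂ) (m : ℕ) :
    fischer (quad n * p) (quad n ^ (m + 1)) =
      2 * (m + 1) * (n + 2 * m) * fischer p (quad n ^ m) := by
  rw [fischer_quad_mul, laplacian_quad_pow_succ, ← smul_eq_C_mul, map_smul, smul_eq_mul]

lemma fischer_quad_pow_ne_zero (hn : 0 < n) (k : ℕ) :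
    fischer (quad n ^ k) (quad n ^ k) ≠ 0 := by
  induction k with
  | zero =>
    rw [pow_zero, ← C_1, ← monomial_zero', fischer_monomial]
    simp [multiFactorial]
  | succ k ih =>
    conv_lhs => arg 1; rw [pow_succ']
    rw [fischer_quad_mul_quad_pow]
    refine mul_ne_zero (mul_ne_zero ?_ ?_) ih
    · exact_mod_cast (by omega : 2 * (k + 1) ≠ 0)
    · exact_mod_cast (by omega : n + 2 * k ≠ 0)

/-- Cancelling j factors of `quad n` on both sides leaves at least one on the right, which becomes a
Laplacian acting on a harmonic polynomial. -/
lemma fischer_quad_pow_mul_zonal {lam : ℝ} (hlam : (n : ℝ) = 2 * lam + 2) (v : Fin n → ℂ)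
    (j m l : ℕ) : fischer (quad n ^ j * zonal lam v l) (quad n ^ (j + m + 1)) = 0 := by
  induction j with
  | zero =>
    rw [pow_zero, one_mul, fischer_comm, zero_add, pow_succ', fischer_quad_mul,
      laplacian_zonal hlam, map_zero]
  | succ j ih =>
    rw [pow_succ', mul_assoc, show j + 1 + m + 1 = (j + m + 1) + 1 by ring,
      fischer_quad_mul_quad_pow, ih, mul_zero]

end MvPolynomial

/-! ### Scalar positive semidefinite kernels and their features. -/

open scoped InnerProductSpace ComplexConjugate

/-- A positive semidefinite scalar kernel. -/
def IsPosKernel {X : Type*} (k : X → X → ℂ) : Prop :=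
  (∀ x y, conj (k x y) = k y x) ∧
    ∀ (s : Finset X) (c : X → ℂ), 0 ≤ (∑ x ∈ s, ∑ y ∈ s, conj (c x) * c y * k x y).re

namespace IsPosKernel

variable {X : Type*} {k k' : X → X → ℂ}

lemma zero : IsPosKernel fun _ _ : X => (0 : ℂ) := ⟨by simp, by simp⟩

lemma add (h : IsPosKernel k) (h' : IsPosKernel k') : IsPosKernel fun x y => k x y + k' x y := by
  refine ⟨fun x y => by rw [map_add, h.1, h'.1], fun s c => ?_⟩
  simp only [mul_add, Finset.sum_add_distrib, Complex.add_re]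
  exact add_nonneg (h.2 s c) (h'.2 s c)

lemma sum {ι : Type*} (t : Finset ι) {k : ι → X → X → ℂ} (h : ∀ i ∈ t, IsPosKernel (k i)) :
    IsPosKernel fun x y => ∑ i ∈ t, k i x y := by
  classical
  induction t using Finset.induction_on with
  | empty => simpa using zero
  | insert i t hi ih =>
    simp only [Finset.sum_insert hi]
    exact (h i (by simp)).add (ih fun j hj => h j (by simp [hj]))

lemma const_mul (h : IsPosKernel k) {a : ℝ} (ha : 0 ≤ a) : IsPosKernel fun x y => a * k x y := by
  refine ⟨fun x y => by rw [map_mul, h.1, Complex.conj_ofReal], fun s c => ?_⟩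
  have : ∑ x ∈ s, ∑ y ∈ s, conj (c x) * c y * (a * k x y) =
      a * ∑ x ∈ s, ∑ y ∈ s, conj (c x) * c y * k x y := by
    simp only [Finset.mul_sum]
    exact Finset.sum_congr rfl fun x _ => Finset.sum_congr rfl fun y _ => by ring
  rw [this, Complex.re_ofReal_mul]
  exact mul_nonneg ha (h.2 s c)

lemma twist (h : IsPosKernel k) (f : X → ℂ) :
    IsPosKernel fun x y => f x * conj (f y) * k x y := by
  refine ⟨fun x y => by simp only [map_mul, h.1, Complex.conj_conj]; ring, fun s c => ?_⟩
  have := h.2 s fun x => c x * conj (f x)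
  convert this using 4 with x _ y _
  simp only [map_mul, Complex.conj_conj]
  ring

lemma of_inner {E : Type*} [NormedAddCommGroup E] [InnerProductSpace ℂ E] (Φ : X → E) :
    IsPosKernel fun x y => ⟪Φ x, Φ y⟫_ℂ := by
  refine ⟨fun x y => inner_conj_symm _ _, fun s c => ?_⟩
  have : ∑ x ∈ s, ∑ y ∈ s, conj (c x) * c y * ⟪Φ x, Φ y⟫_ℂ =
      ⟪∑ x ∈ s, c x • Φ x, ∑ x ∈ s, c x • Φ x⟫_ℂ := by
    rw [sum_inner]
    refine Finset.sum_congr rfl fun x _ => ?_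
    rw [inner_sum]
    refine Finset.sum_congr rfl fun y _ => ?_
    rw [inner_smul_left, inner_smul_right]
    ring
  rw [this, ← RCLike.re_eq_complex_re]
  exact inner_self_nonneg

lemma posSemidef (h : IsPosKernel k) :
    (Matrix.of fun x y => k x y • ContinuousLinearMap.id ℂ ℂ :
      Matrix X X (ℂ →L[ℂ] ℂ)).PosSemidef := by
  have htfae := (RKHS.posSemidef_tfae (𝕜 := ℂ) (V := ℂ)
    (K := Matrix.of fun x y => k x y • ContinuousLinearMap.id ℂ ℂ)).out 0 2
  refine htfae.2 ⟨?_, fun c => ?_⟩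
  · ext x y
    have : star (ContinuousLinearMap.id ℂ ℂ) = ContinuousLinearMap.id ℂ ℂ :=
      ContinuousLinearMap.adjoint_id
    simp [Matrix.conjTranspose_apply, ← h.1 x y, star_smul, this]
  · convert h.2 c.support c using 2
    simp only [Finsupp.sum, RCLike.re_eq_complex_re]
    congr 1
    refine Finset.sum_congr rfl fun x _ => Finset.sum_congr rfl fun y _ => ?_
    simp [← h.1 x y]
    ring

end IsPosKernel

/-- The kernel functions of the space with reproducing kernel `k` have Gram matrix `k`. -/
lemma inner_kerFun_one {X : Type*} (k : X → X → ℂ)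
    [Fact (Matrix.of fun x y => k x y • ContinuousLinearMap.id ℂ ℂ :
      Matrix X X (ℂ →L[ℂ] ℂ)).PosSemidef] (x y : X) :
    ⟪RKHS.kerFun (RKHS.OfKernel (Matrix.of fun x y => k x y • ContinuousLinearMap.id ℂ ℂ :
        Matrix X X (ℂ →L[ℂ] ℂ))) x 1,
      RKHS.kerFun (RKHS.OfKernel (Matrix.of fun x y => k x y • ContinuousLinearMap.id ℂ ℂ :
        Matrix X X (ℂ →L[ℂ] ℂ))) y 1⟫_ℂ = k x y := by
  rw [RKHS.kerFun_inner, RKHS.kerFun_apply, RKHS.OfKernel.kernel_ofKernel]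
  simp

lemma IsPosKernel.exists_features {X : Type} {k : X → X → ℂ} (h : IsPosKernel k) :
    ∃ (E : Type) (_ : NormedAddCommGroup E) (_ : InnerProductSpace ℂ E) (_ : CompleteSpace E)
      (Φ : X → E), ∀ x y, ⟪Φ x, Φ y⟫_ℂ = k x y := by
  have := Fact.mk h.posSemidef
  exact ⟨RKHS.OfKernel (Matrix.of fun x y => k x y • ContinuousLinearMap.id ℂ ℂ :
    Matrix X X (ℂ →L[ℂ] ℂ)), inferInstance, inferInstance, inferInstance, _, inner_kerFun_one k⟩

/-- Cauchy–Schwarz in the feature space. The bound is a sum so that it passes from summability on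
the diagonal to summability off it. -/
lemma IsPosKernel.norm_le {X : Type} {k : X → X → ℂ} (h : IsPosKernel k) (x y : X) :
    ‖k x y‖ ≤ ‖k x x‖ + ‖k y y‖ := by
  obtain ⟨E, _, _, _, Φ, hΦ⟩ := h.exists_features
  rw [← hΦ, ← hΦ x x, ← hΦ y y, inner_self_eq_norm_sq_to_K, inner_self_eq_norm_sq_to_K]
  have := norm_inner_le_norm (𝕜 := ℂ) (Φ x) (Φ y)
  simp only [norm_pow, RCLike.norm_ofReal, abs_norm]
  nlinarith [sq_nonneg (‖Φ x‖ - ‖Φ y‖), sq_nonneg (‖Φ x‖), sq_nonneg ‖Φ y‖]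

/-! ### Positivity and convergence of the homogeneous expansion on the Lie ball. -/

section LieBall

variable {n : ℕ}

lemma quadForm_smul (t : ℂ) (z : EuclideanSpace ℂ (Fin n)) :
    quadForm (t • z) = t ^ 2 * quadForm z := by
  simp [quadForm, mul_pow, Finset.mul_sum]

lemma sum_mul_conj_self (z : EuclideanSpace ℂ (Fin n)) :
    ∑ i, z i * conj (z i) = ((‖z‖ ^ 2 : ℝ) : ℂ) := by
  rw [EuclideanSpace.norm_sq_eq]
  push_cast
  exact Finset.sum_congr rfl fun i _ => by rw [Complex.mul_conj, Complex.normSq_eq_norm_sq]; simp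

lemma norm_quadForm_le (z : EuclideanSpace ℂ (Fin n)) : ‖quadForm z‖ ≤ ‖z‖ ^ 2 := by
  rw [EuclideanSpace.norm_sq_eq]
  exact (norm_sum_le _ _).trans_eq (Finset.sum_congr rfl fun i _ => norm_pow _ _)

lemma smul_mem_lieBall {z : EuclideanSpace ℂ (Fin n)} (hz : z ∈ lieBall n) {t : ℂ}
    (ht : ‖t‖ ≤ 1) : t • z ∈ lieBall n := by
  obtain ⟨h1, h2⟩ := hz
  have h3 := norm_quadForm_le z
  have h0 := norm_nonneg z
  have hb := norm_nonneg (quadForm z)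
  have ht0 := norm_nonneg t
  refine ⟨?_, ?_⟩
  · rw [quadForm_smul, norm_smul, norm_mul, norm_pow]
    set a := ‖z‖ ^ 2 with ha
    set b := ‖quadForm z‖
    set r := ‖t‖ ^ 2 with hr
    have hr1 : r ≤ 1 := pow_le_one₀ ht0 ht
    have hr0 : 0 ≤ r := by positivity
    have ha1 : a < 1 := pow_lt_one₀ h0 h2 two_ne_zero
    have hb2 : b ^ 2 ≤ a := by nlinarith
    have : (‖t‖ * ‖z‖) ^ 2 = r * a := by rw [mul_pow]
    rw [this]
    -- (1 - 2ra + r²b²) - (1 - 2a + b²) = (1 - r)(2a - (1 + r)b²), and the last factor is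
    -- nonnegative since b² ≤ a and r ≤ 1.
    nlinarith [mul_nonneg (sub_nonneg.2 hr1) (by nlinarith : 0 ≤ 2 * a - (1 + r) * b ^ 2)]
  · rw [norm_smul]; nlinarith

lemma mem_lieBall_of_norm_sq_lt {z : EuclideanSpace ℂ (Fin n)} (hz : ‖z‖ ^ 2 < 1 / 2) :
    z ∈ lieBall n := by
  have := sq_nonneg ‖quadForm z‖
  exact ⟨by linarith, by nlinarith [norm_nonneg z]⟩

/-- The component of the kernel `lieH ^ (-ν)` of degree `N`. -/
noncomputable def lieTerm (n : ℕ) (ν : ℝ) (N : ℕ) (z w : EuclideanSpace ℂ (Fin n)) : ℂ :=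
  gegen ν (∑ i, z i * conj (w i)) (quadForm z * conj (quadForm w)) N

lemma conj_lieTerm (ν : ℝ) (N : ℕ) (z w : EuclideanSpace ℂ (Fin n)) :
    conj (lieTerm n ν N z w) = lieTerm n ν N w z := by
  rw [lieTerm, map_gegen _ (by intro c x; simp), lieTerm]
  simp only [map_sum, map_mul, Complex.conj_conj]
  congr 1
  · exact Finset.sum_congr rfl fun i _ => mul_comm _ _
  · ring

lemma lieTerm_smul_left (ν : ℝ) (N : ℕ) (t : ℂ) (z w : EuclideanSpace ℂ (Fin n)) :
    lieTerm n ν N (t • z) w = t ^ N * lieTerm n ν N z w := by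
  rw [lieTerm, lieTerm, ← gegen_smul, quadForm_smul, mul_assoc]
  simp [Finset.mul_sum, mul_assoc]

lemma lieTerm_smul_right (ν : ℝ) (N : ℕ) (t : ℂ) (z w : EuclideanSpace ℂ (Fin n)) :
    lieTerm n ν N z (t • w) = conj t ^ N * lieTerm n ν N z w := by
  rw [← conj_lieTerm, lieTerm_smul_left, map_mul, conj_lieTerm, map_pow]

lemma lieTerm_eq_eval (ν : ℝ) (N : ℕ) (z w : EuclideanSpace ℂ (Fin n)) :
    lieTerm n ν N z w =
      MvPolynomial.eval z.ofLp (MvPolynomial.zonal ν (fun i => conj (w i)) N) := by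
  rw [MvPolynomial.eval_zonal, lieTerm]
  congr 1
  · exact Finset.sum_congr rfl fun i _ => mul_comm _ _
  · simp [quadForm, mul_comm]

/-- The zonal kernels of degree `N` are positive semidefinite. -/
lemma isPosKernel_zonal {lam : ℝ} (hpos : 0 < lam) (hlam : (n : ℝ) = 2 * lam + 2) (N : ℕ) :
    IsPosKernel (lieTerm n lam N) := by
  refine ⟨conj_lieTerm lam N, fun s c => ?_⟩
  obtain ⟨a, ha, h⟩ := MvPolynomial.exists_fischer_zonal hpos hlam N
  set P : MvPolynomial (Fin n) ℂ :=
    ∑ y ∈ s, c y • MvPolynomial.zonal lam (fun i => conj (y i)) N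
  have hP : MvPolynomial.map (starRingEnd ℂ) P =
      ∑ x ∈ s, conj (c x) • MvPolynomial.zonal lam x.ofLp N := by
    simp only [P, map_sum, MvPolynomial.smul_eq_C_mul, map_mul, MvPolynomial.map_C,
      MvPolynomial.map_conj_zonal, Complex.conj_conj]
  have key : ∑ x ∈ s, ∑ y ∈ s, conj (c x) * c y * lieTerm n lam N x y =
      a * MvPolynomial.fischer P (MvPolynomial.map (starRingEnd ℂ) P) := by
    rw [hP]
    simp only [P, map_sum, LinearMap.sum_apply, map_smul, LinearMap.smul_apply, smul_eq_mul,
      Finset.mul_sum]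
    refine Finset.sum_congr rfl fun x _ => Finset.sum_congr rfl fun y _ => ?_
    rw [lieTerm_eq_eval, h]
    ring
  rw [key, Complex.re_ofReal_mul]
  exact mul_nonneg ha.le (MvPolynomial.fischer_map_conj_nonneg P)

lemma isPosKernel_lieTerm {lam ν : ℝ} (hpos : 0 < lam) (hlam : (n : ℝ) = 2 * lam + 2)
    (hν : lam < ν) (N : ℕ) : IsPosKernel (lieTerm n ν N) := by
  have : lieTerm n ν N = fun z w => ∑ j ∈ Finset.range (N + 1), connTerm ν lam
      (∑ i, z i * conj (w i)) (quadForm z * conj (quadForm w)) N j := by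
    ext z w
    exact gegen_connection hpos _ _ N (N + 1) (by omega)
  rw [this]
  refine IsPosKernel.sum _ fun j _ => ?_
  by_cases hj : 2 * j ≤ N
  · have := ((isPosKernel_zonal hpos hlam (N - 2 * j)).twist
      (fun z => quadForm z ^ j)).const_mul (connCoeff_pos hpos hν j (N - 2 * j)).le
    convert this using 3 with z w
    simp [connTerm, hj, lieTerm, mul_pow]
    ring
  · simpa [connTerm, hj] using IsPosKernel.zero

/-- On the diagonal the reciprocal roots are the real numbers a ± d with d² = a² - b². As a < 1, the
inequality 1 - 2a + b² > 0 says exactly that a + d < 1. -/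
lemma summable_lieTerm_self (ν : ℝ) {z : EuclideanSpace ℂ (Fin n)} (hz : z ∈ lieBall n) :
    Summable fun N => lieTerm n ν N z z := by
  obtain ⟨h1, h2⟩ := hz
  have h3 := norm_quadForm_le z
  have hb := norm_nonneg (quadForm z)
  have ha1 : ‖z‖ ^ 2 < 1 := pow_lt_one₀ (norm_nonneg z) h2 two_ne_zero
  set a := ‖z‖ ^ 2
  set b := ‖quadForm z‖ with hb'
  set d := √(a ^ 2 - b ^ 2)
  have hd : d ^ 2 = a ^ 2 - b ^ 2 := Real.sq_sqrt (by nlinarith)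
  have hd0 : 0 ≤ d := Real.sqrt_nonneg _
  have hda : d ≤ a := by nlinarith
  have hd1 : a + d < 1 := by nlinarith
  have e : (fun N => lieTerm n ν N z z) = gegen ν (a : ℂ) ((b : ℂ) ^ 2) := by
    ext N
    rw [lieTerm, sum_mul_conj_self, Complex.mul_conj, Complex.normSq_eq_norm_sq,
      Complex.ofReal_pow ‖quadForm z‖]
  rw [e]
  refine (hasSum_gegen_of_roots ν (α := (a + d : ℝ)) (β := (a - d : ℝ)) ?_ ?_ ?_ ?_).summable
  · push_cast; ring
  · rw [← Complex.ofReal_mul, ← Complex.ofReal_pow]; congr 1; linarith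
  · rw [Complex.norm_real, Real.norm_eq_abs, abs_lt]; constructor <;> linarith
  · rw [Complex.norm_real, Real.norm_eq_abs, abs_lt]; constructor <;> linarith

lemma summable_lieTerm {lam ν : ℝ} (hpos : 0 < lam) (hlam : (n : ℝ) = 2 * lam + 2)
    (hν : lam < ν) {z w : EuclideanSpace ℂ (Fin n)} (hz : z ∈ lieBall n) (hw : w ∈ lieBall n) :
    Summable fun N => lieTerm n ν N z w :=
  .of_norm_bounded ((summable_lieTerm_self ν hz).norm.add (summable_lieTerm_self ν hw).norm)
    fun N => (isPosKernel_lieTerm hpos hlam hν N).norm_le z w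

/-- A natural exponent m > lam involves no choice of branch: the convergent series is an inverse of
h^m. -/
lemma lieH_ne_zero {lam : ℝ} (hpos : 0 < lam) (hlam : (n : ℝ) = 2 * lam + 2)
    {z w : EuclideanSpace ℂ (Fin n)} (hz : z ∈ lieBall n) (hw : w ∈ lieBall n) :
    lieH z w ≠ 0 := by
  obtain ⟨m, hm⟩ := exists_nat_gt lam
  have h := summable_gegen_nat m _ _ (summable_lieTerm hpos hlam hm hz hw)
  have hm0 : m ≠ 0 := by rintro rfl; simp at hm; linarith
  intro h0
  rw [lieH] at h0
  rw [h0, zero_pow hm0, zero_mul] at h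
  exact zero_ne_one h

lemma lieH_smul (t : ℂ) (z w : EuclideanSpace ℂ (Fin n)) :
    lieH (t • z) w = 1 - 2 * (t * ∑ i, z i * conj (w i)) +
      t ^ 2 * (quadForm z * conj (quadForm w)) := by
  rw [lieH, quadForm_smul]
  simp [Finset.mul_sum, mul_assoc]

/-- The homogeneous expansion of the kernel `lieH ^ (-ν)`. -/
lemma hasSum_lieTerm {lam : ℝ} (hpos : 0 < lam) (hlam : (n : ℝ) = 2 * lam + 2) (ν : ℝ)
    {z w : EuclideanSpace ℂ (Fin n)} (hz : z ∈ lieBall n) (hw : w ∈ lieBall n) :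
    HasSum (fun N => lieTerm n ν N z w) (lieH z w ^ (-(ν : ℂ))) := by
  obtain ⟨α, β, hs, hp⟩ := exists_roots (∑ i, z i * conj (w i)) (quadForm z * conj (quadForm w))
  have key (α β : ℂ) (hs : α + β = 2 * ∑ i, z i * conj (w i))
      (hp : α * β = quadForm z * conj (quadForm w)) : ‖α‖ < 1 := by
    -- If |α| ≥ 1, then z/α is still in the ball, yet h(z/α, w) = (1 - α/α)(1 - β/α) = 0.
    by_contra hα
    push Not at hα
    have hα0 : α ≠ 0 := by rintro rfl; simp at hα; linarith
    have hmem := smul_mem_lieBall hz (t := α⁻¹) (by rw [norm_inv]; exact inv_le_one_of_one_le₀ hα)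
    apply lieH_ne_zero hpos hlam hmem hw
    rw [lieH_smul, ← hp]
    have : ∑ i, z i * conj (w i) = (α + β) / 2 := by rw [hs]; ring
    rw [this]
    field_simp
    ring
  exact hasSum_gegen_of_roots ν hs hp (key α β hs hp)
    (key β α (by rw [add_comm, hs]) (by rw [mul_comm, hp]))

end LieBall

/-! ### Transfer from a feature space to the reproducing kernel Hilbert space. -/

open Filter Topology in
/-- Two families with the same Gram matrix have isometric closed spans. -/
lemma exists_inner_eq_of_gram_eq {X E H : Type*} [NormedAddCommGroup E] [InnerProductSpace ℂ E]
    [NormedAddCommGroup H] [InnerProductSpace ℂ H] [CompleteSpace H] (Φ : X → E) (Ψ : X → H)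
    (hΨ : ∀ x y, ⟪Ψ x, Ψ y⟫_ℂ = ⟪Φ x, Φ y⟫_ℂ) {e : E}
    (he : e ∈ (Submodule.span ℂ (Set.range Φ)).topologicalClosure) :
    ∃ f : H, (∀ x, ⟪Ψ x, f⟫_ℂ = ⟪Φ x, e⟫_ℂ) ∧ ‖f‖ = ‖e‖ := by
  have hnorm (c : X →₀ ℂ) :
      ‖Finsupp.linearCombination ℂ Ψ c‖ = ‖Finsupp.linearCombination ℂ Φ c‖ := by
    rw [@norm_eq_sqrt_re_inner ℂ, @norm_eq_sqrt_re_inner ℂ]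
    simp only [Finsupp.linearCombination_apply, Finsupp.sum, sum_inner, inner_sum,
      inner_smul_left, inner_smul_right, hΨ]
  have heval (c : X →₀ ℂ) (x : X) : ⟪Ψ x, Finsupp.linearCombination ℂ Ψ c⟫_ℂ =
      ⟪Φ x, Finsupp.linearCombination ℂ Φ c⟫_ℂ := by
    simp only [Finsupp.linearCombination_apply, Finsupp.sum, inner_sum, inner_smul_right, hΨ]
  obtain ⟨u, hu, hue⟩ := mem_closure_iff_seq_limit.1 he
  choose c hc using fun m => (Finsupp.mem_span_range_iff_exists_finsupp.1 (hu m))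
  have hc' (m : ℕ) : Finsupp.linearCombination ℂ Φ (c m) = u m := hc m
  have hdist (m m' : ℕ) : dist (Finsupp.linearCombination ℂ Ψ (c m))
      (Finsupp.linearCombination ℂ Ψ (c m')) = dist (u m) (u m') := by
    rw [dist_eq_norm, dist_eq_norm, ← map_sub, hnorm, map_sub, hc', hc']
  have hcauchy : CauchySeq fun m => Finsupp.linearCombination ℂ Ψ (c m) := by
    have := hue.cauchySeq
    rw [Metric.cauchySeq_iff] at this ⊢
    simpa only [hdist] using this
  obtain ⟨f, hf⟩ := cauchySeq_tendsto_of_complete hcauchy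
  refine ⟨f, fun x => ?_, ?_⟩
  · have h2 := (tendsto_const_nhds (x := Ψ x)).inner (𝕜 := ℂ) hf
    have h3 := (tendsto_const_nhds (x := Φ x)).inner (𝕜 := ℂ) hue
    simp only [heval, hc'] at h2
    exact tendsto_nhds_unique h2 h3
  · have h2 := hf.norm
    simp only [hnorm, hc'] at h2
    exact tendsto_nhds_unique h2 hue.norm

/-- A vector in the closed span of the features of a kernel gives a function of the same norm in
the Hilbert space with that reproducing kernel. -/
lemma exists_mem_ofKernel {X E : Type*} [NormedAddCommGroup E] [InnerProductSpace ℂ E]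
    (k : X → X → ℂ) [Fact (Matrix.of fun x y => k x y • ContinuousLinearMap.id ℂ ℂ :
      Matrix X X (ℂ →L[ℂ] ℂ)).PosSemidef]
    (Φ : X → E) (hΦ : ∀ x y, ⟪Φ x, Φ y⟫_ℂ = k x y) {e : E}
    (he : e ∈ (Submodule.span ℂ (Set.range Φ)).topologicalClosure) :
    ∃ f : RKHS.OfKernel (Matrix.of fun x y => k x y • ContinuousLinearMap.id ℂ ℂ :
      Matrix X X (ℂ →L[ℂ] ℂ)), (∀ x, f x = ⟪Φ x, e⟫_ℂ) ∧ ‖f‖ = ‖e‖ := by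
  obtain ⟨f, hf, hn⟩ := exists_inner_eq_of_gram_eq Φ _
    (fun x y => (inner_kerFun_one k x y).trans (hΦ x y).symm) he
  refine ⟨f, fun x => ?_, hn⟩
  rw [← hf, RKHS.kerFun_inner]
  simp

/-- A power series that vanishes identically on the unit disk has zero coefficients. -/
lemma eq_zero_of_hasSum_pow_mul {b : ℕ → ℂ}
    (h : ∀ t : ℂ, ‖t‖ < 1 → HasSum (fun N => t ^ N * b N) 0) (N : ℕ) : b N = 0 := by
  set p := FormalMultilinearSeries.ofScalars ℂ b
  have hp : HasFPowerSeriesOnBall (fun _ : ℂ => (0 : ℂ)) p 0 (1 / 2 : NNReal) := by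
    refine ⟨?_, by simp, fun {y} hy => ?_⟩
    · refine p.le_radius_of_summable_norm ?_
      have := (h (1 / 2) (by norm_num)).summable.norm
      refine this.of_nonneg_of_le (fun m => by positivity) fun m => ?_
      have : ‖p m‖ = ‖b m‖ := FormalMultilinearSeries.ofScalars_norm ..
      rw [this, norm_mul, mul_comm]
      simp
    · have hy' : ‖y‖ < 1 := by
        rw [Metric.mem_eball, edist_zero_right, enorm_eq_nnnorm, ENNReal.coe_lt_coe,
          ← NNReal.coe_lt_coe] at hy
        refine hy.trans ?_
        push_cast
        norm_num
      simpa [p, FormalMultilinearSeries.ofScalars_apply_eq, mul_comm] using h y hy'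
  have h0 : p = 0 := hp.hasFPowerSeriesAt.eq_zero
  rw [← FormalMultilinearSeries.coeff_ofScalars (𝕜 := ℂ) (p := b) (n := N)]
  change p.coeff N = 0
  rw [h0]
  rfl

/-! ### The vector representing q^k and its norm. -/

section

variable {n : ℕ}

/-- Pairing the homogeneous kernel with the functional `fischer · (quad n ^ k)` gives a
multiple of `quadForm ^ k`. -/
lemma sum_mul_lieTerm {lam : ℝ} (hpos : 0 < lam) (hlam : (n : ℝ) = 2 * lam + 2) (ν : ℝ) (k : ℕ)
    {c : (Fin n → ℂ) →₀ ℂ}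
    (hc : ∀ p : MvPolynomial (Fin n) ℂ, p.IsHomogeneous (2 * k) →
      MvPolynomial.fischer p (MvPolynomial.quad n ^ k) =
        c.sum fun v a => a * MvPolynomial.eval v p) (z : EuclideanSpace ℂ (Fin n)) :
    ∑ v ∈ c.support, c v * lieTerm n ν (2 * k) (WithLp.toLp 2 v) z =
      connCoeff ν lam k 0 * conj (quadForm z) ^ k *
        MvPolynomial.fischer (MvPolynomial.quad n ^ k) (MvPolynomial.quad n ^ k) := by
  have hterm (j : ℕ) (hj : j ∈ Finset.range (k + 1)) : ∑ v ∈ c.support, c v *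
      connTerm ν lam (∑ i, v i * conj (z i))
        (quadForm (WithLp.toLp 2 v) * conj (quadForm z)) (2 * k) j =
      connCoeff ν lam j (2 * k - 2 * j) * conj (quadForm z) ^ j *
        MvPolynomial.fischer (MvPolynomial.quad n ^ j *
          MvPolynomial.zonal lam (fun i => conj (z i)) (2 * k - 2 * j))
          (MvPolynomial.quad n ^ k) := by
    have hj' : 2 * j ≤ 2 * k := by simp at hj; omega
    have hhom : (MvPolynomial.quad n ^ j *
          MvPolynomial.zonal lam (fun i => conj (z i)) (2 * k - 2 * j)).IsHomogeneous (2 * k) := by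
      have := (MvPolynomial.isHomogeneous_quad_pow (n := n) j).mul
        (MvPolynomial.isHomogeneous_zonal lam (fun i => conj (z i)) (2 * k - 2 * j))
      rwa [Nat.add_sub_cancel' hj'] at this
    rw [hc _ hhom, Finsupp.sum, Finset.mul_sum]
    refine Finset.sum_congr rfl fun v _ => ?_
    have hl := lieTerm_eq_eval lam (2 * k - 2 * j) (WithLp.toLp 2 v) z
    simp only [lieTerm] at hl
    rw [map_mul, map_pow, ← hl, MvPolynomial.eval_quad, connTerm, if_pos hj', mul_pow]
    simp only [quadForm]
    ring
  have hexp (v : Fin n → ℂ) := gegen_connection (ν := ν) hpos (∑ i, v i * conj (z i))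
    (quadForm (WithLp.toLp 2 v) * conj (quadForm z)) (2 * k) (k + 1) (by omega)
  simp only [lieTerm, hexp, Finset.mul_sum]
  -- By orthogonality only the summand j = k survives.
  rw [Finset.sum_comm, Finset.sum_congr rfl hterm, Finset.sum_range_succ, Finset.sum_eq_zero]
  · simp [MvPolynomial.zonal_zero]
  · intro j hj
    obtain ⟨m, rfl⟩ : ∃ m, k = j + m + 1 := ⟨k - j - 1, by simp at hj; omega⟩
    rw [MvPolynomial.fischer_quad_pow_mul_zonal hlam, mul_zero]

/-- Features of the homogeneous components scale like antiholomorphic monomials. -/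
lemma lieTerm_feature_smul {ν : ℝ} {N : ℕ} {E : Type*} [NormedAddCommGroup E]
    [InnerProductSpace ℂ E] {Φ : EuclideanSpace ℂ (Fin n) → E}
    (hΦ : ∀ z w, ⟪Φ z, Φ w⟫_ℂ = lieTerm n ν N z w) (t : ℂ) (z : EuclideanSpace ℂ (Fin n)) :
    Φ (t • z) = conj t ^ N • Φ z := by
  rw [← sub_eq_zero, ← inner_self_eq_zero (𝕜 := ℂ)]
  simp only [inner_sub_left, inner_sub_right, inner_smul_left, inner_smul_right, hΦ,
    lieTerm_smul_left, lieTerm_smul_right, map_pow, Complex.conj_conj]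
  ring

/-- In a feature space for the component of degree `2 * k`, the function `quadForm ^ k` is
represented by a combination of features. -/
lemma exists_feature_quadForm_pow {lam ν : ℝ} (hpos : 0 < lam) (hlam : (n : ℝ) = 2 * lam + 2)
    (hν : lam < ν) (k : ℕ) {E : Type*} [NormedAddCommGroup E] [InnerProductSpace ℂ E]
    {Φ : EuclideanSpace ℂ (Fin n) → E}
    (hΦ : ∀ z w, ⟪Φ z, Φ w⟫_ℂ = lieTerm n ν (2 * k) z w) :
    ∃ e ∈ Submodule.span ℂ (Set.range Φ), (∀ z, ⟪Φ z, e⟫_ℂ = quadForm z ^ k) ∧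
      ‖e‖ ^ 2 = (connCoeff ν lam k 0)⁻¹ := by
  obtain ⟨c, hc⟩ := MvPolynomial.exists_fischer_quad_eq_eval (n := n) k
  have hn : 0 < n := by
    have : (0 : ℝ) < n := by rw [hlam]; positivity
    exact_mod_cast this
  have hC := MvPolynomial.fischer_quad_pow_ne_zero hn k
  have hsum := sum_mul_lieTerm hpos hlam ν k hc
  have hCsum := hc _ (MvPolynomial.isHomogeneous_quad_pow k)
  set C := MvPolynomial.fischer (MvPolynomial.quad n ^ k) (MvPolynomial.quad n ^ k)
  have ha := connCoeff_pos hpos hν k 0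
  set a := connCoeff ν lam k 0
  have ha' : (a : ℂ) ≠ 0 := by exact_mod_cast ha.ne'
  have hC' : conj C ≠ 0 := by simpa using hC
  set e₀ : E := ∑ v ∈ c.support, conj (c v) • Φ (WithLp.toLp 2 v)
  have he₀ (z : EuclideanSpace ℂ (Fin n)) : ⟪Φ z, e₀⟫_ℂ = a * quadForm z ^ k * conj C := by
    have := congrArg conj (hsum z)
    simp only [map_sum, map_mul, map_pow, Complex.conj_conj, Complex.conj_ofReal,
      conj_lieTerm] at this
    simp only [e₀, inner_sum, inner_smul_right, hΦ, this]
  have hn₀ : ⟪e₀, e₀⟫_ℂ = a * C * conj C := by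
    conv_lhs => arg 2; rw [show e₀ = ∑ v ∈ c.support, conj (c v) • Φ (WithLp.toLp 2 v) from rfl]
    simp only [sum_inner, inner_smul_left, he₀, Complex.conj_conj]
    rw [hCsum, Finsupp.sum, Finset.mul_sum, Finset.sum_mul]
    refine Finset.sum_congr rfl fun v _ => ?_
    rw [map_pow, MvPolynomial.eval_quad]
    simp only [quadForm]
    ring
  -- `e₀` represents a conj(C) q^k and has squared norm a|C|²; after normalization the squared norm
  -- is 1/a.
  refine ⟨(a * conj C)⁻¹ • e₀, ?_, fun z => ?_, ?_⟩
  · exact Submodule.smul_mem _ _ (Submodule.sum_mem _ fun v _ =>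
      Submodule.smul_mem _ _ (Submodule.subset_span ⟨_, rfl⟩))
  · rw [inner_smul_right, he₀]
    field_simp
  · have : ((‖(a * conj C)⁻¹ • e₀‖ ^ 2 : ℝ) : ℂ) = ((a⁻¹ : ℝ) : ℂ) := by
      have h := inner_self_eq_norm_sq_to_K (𝕜 := ℂ) ((a * conj C)⁻¹ • e₀)
      push_cast
      refine h.symm.trans ?_
      rw [inner_smul_left, inner_smul_right, hn₀]
      simp only [map_inv₀, map_mul, Complex.conj_conj, Complex.conj_ofReal]
      field_simp
    exact_mod_cast this

end

/-- The features of the homogeneous components, combined into features for the whole kernel. -/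
lemma exists_lieKernel_features {n : ℕ} {lam ν : ℝ} (hpos : 0 < lam)
    (hlam : (n : ℝ) = 2 * lam + 2) (hν : lam < ν) (k : ℕ) :
    ∃ (E : Type) (_ : NormedAddCommGroup E) (_ : InnerProductSpace ℂ E) (Φ : lieBall n → E),
      (∀ z w, ⟪Φ z, Φ w⟫_ℂ = lieH z.1 w.1 ^ (-(ν : ℂ))) ∧
      ∃ e ∈ (Submodule.span ℂ (Set.range Φ)).topologicalClosure,
        (∀ z, ⟪Φ z, e⟫_ℂ = quadForm z.1 ^ k) ∧ ‖e‖ ^ 2 = (connCoeff ν lam k 0)⁻¹ := by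
  choose F i1 i2 i3 φ hφ using fun N => (isPosKernel_lieTerm hpos hlam hν N).exists_features
  -- The squared norms of the components are the diagonal values of the homogeneous parts.
  have hmem (z : lieBall n) : Memℓp (fun N => φ N z.1) 2 := by
    refine memℓp_gen ?_
    refine (summable_lieTerm_self ν z.2).norm.congr fun N => ?_
    rw [← hφ, inner_self_eq_norm_sq_to_K]
    simp
  set Φ : lieBall n → lp F 2 := fun z => ⟨fun N => φ N z.1, hmem z⟩
  have hΦ (z w : lieBall n) : ⟪Φ z, Φ w⟫_ℂ = lieH z.1 w.1 ^ (-(ν : ℂ)) := by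
    refine (lp.hasSum_inner (𝕜 := ℂ) (Φ z) (Φ w)).unique ?_
    simp only [Φ, hφ]
    exact hasSum_lieTerm hpos hlam ν z.2 w.2
  obtain ⟨e, hespan, he, hnorm⟩ := exists_feature_quadForm_pow hpos hlam hν k (hφ (2 * k))
  refine ⟨lp F 2, inferInstance, inferInstance, Φ, hΦ, lp.single 2 (2 * k) e, ?_, fun z => ?_, ?_⟩
  -- Membership in the closed span is tested against any g orthogonal to all features. Replacing z
  -- by tz turns this orthogonality into a vanishing power series in t, so g is orthogonal to the
  -- features degree by degree.
  · rw [← Submodule.orthogonal_orthogonal_eq_closure, Submodule.mem_orthogonal]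
    intro g hg
    rw [lp.inner_single_right]
    have hg0 (z : lieBall n) : ⟪Φ z, g⟫_ℂ = 0 :=
      (Submodule.mem_orthogonal _ _).1 hg _ (Submodule.subset_span ⟨z, rfl⟩)
    have hball (z : lieBall n) (N : ℕ) : ⟪φ N z.1, g N⟫_ℂ = 0 := by
      refine eq_zero_of_hasSum_pow_mul (b := fun N => ⟪φ N z.1, g N⟫_ℂ) (fun t ht => ?_) N
      have := lp.hasSum_inner (𝕜 := ℂ) (Φ ⟨t • z.1, smul_mem_lieBall z.2 ht.le⟩) g
      rw [hg0] at this
      have heq : (fun N => t ^ N * ⟪φ N z.1, g N⟫_ℂ) = fun N => ⟪φ N (t • z.1), g N⟫_ℂ := by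
        ext N
        rw [lieTerm_feature_smul (hφ N), inner_smul_left]
        simp
      rw [heq]
      exact this
    have hall (v : EuclideanSpace ℂ (Fin n)) (N : ℕ) : ⟪φ N v, g N⟫_ℂ = 0 := by
      -- This factor moves an arbitrary v into the ball; homogeneity then removes it.
      set r : ℝ := (2 * (1 + ‖v‖))⁻¹
      have hr : 0 < r := by positivity
      have hrv : ‖(r : ℂ) • v‖ ^ 2 < 1 / 2 := by
        have h1 : r * ‖v‖ ≤ 1 / 2 := by
          simp only [r]
          rw [inv_mul_le_iff₀ (by positivity)]
          linarith
        rw [norm_smul, Complex.norm_real, Real.norm_of_nonneg hr.le]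
        nlinarith [mul_nonneg hr.le (norm_nonneg v)]
      have h := hball ⟨(r : ℂ) • v, mem_lieBall_of_norm_sq_lt hrv⟩ N
      rw [lieTerm_feature_smul (hφ N), inner_smul_left] at h
      refine (mul_eq_zero.1 h).resolve_left ?_
      simp [hr.ne']
    have : Submodule.span ℂ (Set.range (φ (2 * k))) ≤ (ℂ ∙ g (2 * k))ᗮ := by
      rw [Submodule.span_le]
      rintro _ ⟨v, rfl⟩
      exact Submodule.mem_orthogonal_singleton_iff_inner_left.2 (hall v _)
    exact Submodule.mem_orthogonal_singleton_iff_inner_right.1 (this hespan)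
  · rw [lp.inner_single_right]
    exact he z.1
  · rw [lp.norm_single (by norm_num), hnorm]

theorem mainTheorem10 (n : ℕ) (hn : 2 < n) (ν : ℝ) (hν : ((n : ℝ) - 2) / 2 < ν) (k : ℕ) :
    ∃ _ : Fact (lieKernel n ν).PosSemidef, ∃ f : LieHilbert n ν,
      (∀ z : lieBall n, f z = quadForm (z : EuclideanSpace ℂ (Fin n)) ^ k) ∧
      ‖f‖ ^ 2 = (k.factorial : ℝ) * poch ((n : ℝ) / 2) k /
        (poch ν k * poch (ν - ((n : ℝ) - 2) / 2) k) := by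
  have hn' : (2 : ℝ) < n := by exact_mod_cast hn
  have hpos : 0 < ((n : ℝ) - 2) / 2 := by linarith
  obtain ⟨E, _, _, Φ, hΦ, e, he, hval, hnorm⟩ :=
    exists_lieKernel_features hpos (by ring : (n : ℝ) = 2 * (((n : ℝ) - 2) / 2) + 2) hν k
  have hK : IsPosKernel fun z w : lieBall n => lieH z.1 w.1 ^ (-(ν : ℂ)) := by
    have := IsPosKernel.of_inner Φ
    simpa only [hΦ] using this
  have hfact : Fact (lieKernel n ν).PosSemidef := ⟨hK.posSemidef⟩
  refine ⟨hfact, ?_⟩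
  have : Fact (Matrix.of fun z w : lieBall n =>
    lieH z.1 w.1 ^ (-(ν : ℂ)) • ContinuousLinearMap.id ℂ ℂ).PosSemidef := hfact
  obtain ⟨f, hf, hfn⟩ := exists_mem_ofKernel
    (fun z w : lieBall n => lieH z.1 w.1 ^ (-(ν : ℂ))) Φ hΦ he
  refine ⟨f, fun z => (hf z).trans (hval z), ?_⟩
  have hfn' : ‖f‖ ^ 2 = (connCoeff ν (((n : ℝ) - 2) / 2) k 0)⁻¹ := by rw [hfn, hnorm]
  refine hfn'.trans ?_
  rw [connCoeff_zero_right ν hpos, inv_div, show ((n : ℝ) - 2) / 2 + 1 = n / 2 by ring]
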